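/- \textbf{Setting.} Functions on the circle are identified with $2\pi$-periodic functions on $\mathbb R$. For functions $g,u,v$ on the circle put $$\mathcal G_g(u,v)(x)=\int_{-\pi}^{\pi}\int_{-\pi}^{\pi} u(x')\,v(x'+y)\,g\!\left(x-x'-\tfrac y2\right)\frac{dx'}{2\pi}\frac{dy}{2\pi},$$ and consider the kinetic equation (midpoint alignment with noise $g$, constant collision rate, the ``Maxwellian case'') $$\partial_t f=\mathcal G_g(f,f)-f\int_{-\pi}^{\pi}f(\cdot+y)\,\frac{dy}{2\pi}.\qquad(*)$$ The Fourier coefficients of a continuous even $f$ with $\int_{-\pi}^{\pi} f\,\frac{dx}{2\pi}=1$ are $a_k=\int_{-\pi}^{\pi} f(x)\cos(kx)\,\frac{dx}{2\pi}$. At such a stationary solution $f$, linearization of $(*)$ on perturbations $h$ of zero mean (continuous, complex valued) gives $\partial_t h=(T_f-I)h$ with $T_fh=\mathcal G_g(f,h)+\mathcal G_g(h,f)$. The stationary solution $f$ is called linearly stable (in a class of perturbations invariant under $T_f$) if the spectrum of $T_f-I$ on that class lies in $\{\operatorname{Re} z<0\}$, and linearly unstable if $T_f-I$ has an eigenvalue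 with positive real part. A leading eigenvalue of $T_f$ is a real eigenvalue $\lambda$ such that all other points of the spectrum of $T_f$ have modulus smaller than $\lambda$; the corresponding growth rate of the linearized equation is $\lambda-1$. \textbf{Hypothesis.} Let $N\ge 2$, and for $2\le k\le N$ let $\gamma_k:[0,1]\to[-1,1]$ be $C^2$ functions with $\gamma_2(\pi/4)>0$. For $\gamma_1\in[0,1]$ let $$g_{\gamma_1}(x)=1+2\gamma_1\cos x+2\sum_{k=2}^N\gamma_k(\gamma_1)\cos kx .$$ (Nonnegativity of $g_{\gamma_1}$, which makes it a probability density with respect to $\frac{dx}{2\pi}$, is not needed.) \textbf{Theorem.} Consider $(*)$ with $g=g_{\gamma_1}$. (i) For every $\gamma_1\in[0,1]$ the uniform distribution $f=1$ is stationary. It is linearly stable (with respect to all perturbations of zero mean) if $\gamma_1<\pi/4$, and linearly unstable (already with respect to even perturbations) if $\gamma_1>\pi/4$. (ii) There is $\gamma_{\max}\in(\pi/4,1]$ such that for every $\gamma_1\in(\pi/4,\gamma_{\max})$ there is a non-uniform stationary solution of $(*)$ which is an even, continuous probability density, with Fourier coefficients $a_0=1$, $a_1>0$, $a_k=0$ for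 $k>N$, and such that, as $\gamma_1\downarrow\pi/4$, $$a_1=\sqrt{\frac{12(\gamma_1-\pi/4)}{\pi\,\gamma_2(\pi/4)}}+O\big((\gamma_1-\pi/4)^{3/2}\big).$$ In particular $a_1$ is of exact order $(\gamma_1-\pi/4)^{1/2}$: the critical exponent is $1/2$. (iii) For every $\gamma_1\in(\pi/4,\gamma_{\max})$ the solution in (ii) is linearly stable with respect to even perturbations of zero mean, and $T_f$ on these perturbations has a leading eigenvalue $\lambda(\gamma_1)$ with, as $\gamma_1\downarrow\pi/4$, $$\lambda(\gamma_1)=1-\frac8\pi(\gamma_1-\pi/4)+O\big((\gamma_1-\pi/4)^{3/2}\big).$$ -/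

import Mathlib

open Real

noncomputable section

namespace CircleAlignment

/-! ### The kinetic equation on the circle (Maxwellian case)

Functions on the circle are `2π`-periodic functions on `ℝ`; the reference measure is `dx / 2π`
on `[-π, π]`. -/

/-- The mean `∫_{-π}^{π} u(x) dx / 2π`. -/
def mean {𝕜 : Type*} [RCLike 𝕜] (u : ℝ → 𝕜) : 𝕜 :=
  (2 * π)⁻¹ • ∫ x in (-π)..π, u x

/-- The bilinear gain term
`∫_{-π}^{π} ∫_{-π}^{π} u(x') v(x' + y) g(x - x' - y/2) dx'/2π dy/2π`:
two particles at `x'` and `x' + y`, `-π < y < π`, jump to a `g`-distributed position around the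
midpoint `x' + y/2` of the shortest arc between them. -/
def gain {𝕜 : Type*} [RCLike 𝕜] (g : ℝ → ℝ) (u v : ℝ → 𝕜) (x : ℝ) : 𝕜 :=
  mean fun y : ℝ => mean fun x' : ℝ => g (x - x' - y / 2) • (u x' * v (x' + y))

/-- The right-hand side of the kinetic equation `∂ₜ f = collision g f` with constant collision
rate: `gain g f f x - f(x) ∫ f(x + y) dy/2π`. -/
def collision {𝕜 : Type*} [RCLike 𝕜] (g : ℝ → ℝ) (f : ℝ → 𝕜) (x : ℝ) : 𝕜 :=
  gain g f f x - f x * mean fun y : ℝ => f (x + y)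

/-- Continuous even real functions on the circle of total mass one. (Nonnegativity, which makes
such a function a probability density, is stated separately.) -/
structure EvenProfile where
  toFun : ℝ → ℝ
  continuous_toFun : Continuous toFun
  periodic_toFun : Function.Periodic toFun (2 * π)
  even_toFun : Function.Even toFun
  mean_toFun : mean toFun = 1

instance : CoeFun EvenProfile (fun _ => ℝ → ℝ) := ⟨EvenProfile.toFun⟩

/-- `f` is a stationary solution of `∂ₜ f = collision g f`. -/
def IsStationary (g f : EvenProfile) : Prop := ∀ x : ℝ, collision g f x = 0

/-- The `k`-th Fourier coefficient `∫ f(x) e^{-ikx} dx/2π` of an even function `f`, in which only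
the cosine contributes. -/
def fourierCos (f : EvenProfile) (k : ℕ) : ℝ := mean fun x : ℝ => f x * Real.cos (k * x)

/-! ### Elementary facts on means -/

section mean

variable {𝕜 : Type*} [RCLike 𝕜]

theorem mean_add {u v : ℝ → 𝕜} (hu : Continuous u) (hv : Continuous v) :
    mean (fun x => u x + v x) = mean u + mean v := by
  unfold mean
  rw [intervalIntegral.integral_add (hu.intervalIntegrable _ _) (hv.intervalIntegrable _ _),
    smul_add]

theorem mean_const_mul (c : 𝕜) (u : ℝ → 𝕜) : mean (fun x => c * u x) = c * mean u := by
  unfold mean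
  rw [intervalIntegral.integral_const_mul, mul_smul_comm]

theorem mean_smul_const (g : ℝ → ℝ) (c : 𝕜) : mean (fun x => g x • c) = mean g • c := by
  unfold mean
  rw [intervalIntegral.integral_smul_const, smul_assoc]

theorem mean_const (c : 𝕜) : mean (fun _ : ℝ => c) = c := by
  unfold mean
  rw [intervalIntegral.integral_const, smul_smul]
  have : (2 * π)⁻¹ * (π - -π) = 1 := by field_simp; ring
  rw [this, one_smul]

theorem mean_comp_add {u : ℝ → 𝕜} (hu : Function.Periodic u (2 * π)) (c : ℝ) :
    mean (fun x => u (x + c)) = mean u := by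
  unfold mean
  rw [intervalIntegral.integral_comp_add_right u c]
  have h := hu.intervalIntegral_add_eq (-π + c) (-π)
  rw [show -π + c + 2 * π = π + c by ring, show -π + 2 * π = π by ring] at h
  rw [h]

theorem mean_comp_neg (u : ℝ → 𝕜) : mean (fun x => u (-x)) = mean u := by
  unfold mean
  rw [intervalIntegral.integral_comp_neg u, neg_neg]

theorem mean_comm {F : ℝ → ℝ → 𝕜} (hF : Continuous (Function.uncurry F)) :
    mean (fun x => mean fun y => F x y) = mean (fun y => mean fun x => F x y) := by
  have h : MeasureTheory.IntegrableOn (Function.uncurry F) (Set.uIcc (-π) π ×ˢ Set.uIcc (-π) π)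
      (MeasureTheory.volume.prod MeasureTheory.volume) :=
    hF.continuousOn.integrableOn_compact (isCompact_uIcc.prod isCompact_uIcc)
  unfold mean
  rw [intervalIntegral.integral_smul, intervalIntegral.integral_smul,
    MeasureTheory.intervalIntegral_intervalIntegral_swap]
  exact h.mono_set (Set.prod_mono Set.uIoc_subset_uIcc Set.uIoc_subset_uIcc)

theorem continuous_mean {X : Type*} [TopologicalSpace X] [FirstCountableTopology X]
    [LocallyCompactSpace X] {F : X → ℝ → 𝕜} (hF : Continuous (Function.uncurry F)) :
    Continuous fun x => mean (F x) := by
  unfold mean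
  exact (intervalIntegral.continuous_parametric_intervalIntegral_of_continuous' hF _ _).const_smul _

end mean

/-! ### Elementary facts on the gain term -/

section gain

variable {g : ℝ → ℝ} {u v w : ℝ → ℂ}

theorem continuous_kernel (hg : Continuous g) (hu : Continuous u) (hv : Continuous v) :
    Continuous fun p : (ℝ × ℝ) × ℝ =>
      g (p.1.1 - p.2 - p.1.2 / 2) • (u p.2 * v (p.2 + p.1.2)) := by
  fun_prop

theorem continuous_inner (hg : Continuous g) (hu : Continuous u) (hv : Continuous v) :
    Continuous fun p : ℝ × ℝ =>
      mean fun x' : ℝ => g (p.1 - x' - p.2 / 2) • (u x' * v (x' + p.2)) :=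
  continuous_mean (X := ℝ × ℝ)
    (F := fun p x' => g (p.1 - x' - p.2 / 2) • (u x' * v (x' + p.2)))
    (continuous_kernel hg hu hv)

theorem continuous_gain (hg : Continuous g) (hu : Continuous u) (hv : Continuous v) :
    Continuous (gain g u v) :=
  continuous_mean (F := fun x y => mean fun x' : ℝ => g (x - x' - y / 2) • (u x' * v (x' + y)))
    (continuous_inner hg hu hv)

theorem continuous_slice (hg : Continuous g) (hu : Continuous u) (hv : Continuous v) (x : ℝ) :
    Continuous fun y : ℝ => mean fun x' : ℝ => g (x - x' - y / 2) • (u x' * v (x' + y)) :=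
  continuous_mean (F := fun y x' => g (x - x' - y / 2) • (u x' * v (x' + y)))
    (by unfold Function.uncurry; fun_prop)

theorem gain_add_right (hg : Continuous g) (hu : Continuous u) (hv : Continuous v)
    (hw : Continuous w) (x : ℝ) :
    gain g u (fun t => v t + w t) x = gain g u v x + gain g u w x := by
  have e : ∀ y : ℝ, (mean fun x' : ℝ => g (x - x' - y / 2) • (u x' * (v (x' + y) + w (x' + y))))
      = (mean fun x' : ℝ => g (x - x' - y / 2) • (u x' * v (x' + y)))
        + mean fun x' : ℝ => g (x - x' - y / 2) • (u x' * w (x' + y)) := by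
    intro y
    rw [← mean_add (by fun_prop) (by fun_prop)]
    congr 1; funext x'
    rw [← smul_add, mul_add]
  unfold gain
  simp only [e]
  exact mean_add (continuous_slice hg hu hv x) (continuous_slice hg hu hw x)

theorem gain_add_left (hg : Continuous g) (hu : Continuous u) (hv : Continuous v)
    (hw : Continuous w) (x : ℝ) :
    gain g (fun t => v t + w t) u x = gain g v u x + gain g w u x := by
  have e : ∀ y : ℝ, (mean fun x' : ℝ => g (x - x' - y / 2) • ((v x' + w x') * u (x' + y)))
      = (mean fun x' : ℝ => g (x - x' - y / 2) • (v x' * u (x' + y)))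
        + mean fun x' : ℝ => g (x - x' - y / 2) • (w x' * u (x' + y)) := by
    intro y
    rw [← mean_add (by fun_prop) (by fun_prop)]
    congr 1; funext x'
    rw [← smul_add, add_mul]
  unfold gain
  simp only [e]
  exact mean_add (continuous_slice hg hv hu x) (continuous_slice hg hw hu x)

theorem gain_smul_right (c : ℂ) (x : ℝ) :
    gain g u (fun t => c * v t) x = c * gain g u v x := by
  unfold gain
  rw [← mean_const_mul]
  congr 1; funext y
  rw [← mean_const_mul]
  congr 1; funext x'
  rw [mul_smul_comm]; ring_nf

theorem gain_smul_left (c : ℂ) (x : ℝ) :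
    gain g (fun t => c * v t) u x = c * gain g v u x := by
  unfold gain
  rw [← mean_const_mul]
  congr 1; funext y
  rw [← mean_const_mul]
  congr 1; funext x'
  rw [mul_smul_comm]; ring_nf

theorem periodic_gain (hg : Function.Periodic g (2 * π)) :
    Function.Periodic (gain g u v) (2 * π) := by
  intro x
  unfold gain
  congr 1; funext y; congr 1; funext x'
  rw [show x + 2 * π - x' - y / 2 = (x - x' - y / 2) + 2 * π by ring, hg]

theorem even_gain (hg : Function.Even g) (hu : Function.Even u) (hv : Function.Even v) :
    Function.Even (gain g u v) := by
  intro x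
  unfold gain
  rw [← mean_comp_neg]
  congr 1; funext y
  rw [← mean_comp_neg]
  congr 1; funext x'
  rw [show -x - -x' - -y / 2 = -(x - x' - y / 2) by ring, hg, hu,
    show -x' + -y = -(x' + y) by ring, hv]

theorem mean_gain (hg : Continuous g) (hgp : Function.Periodic g (2 * π)) (hg1 : mean g = 1)
    (hu : Continuous u) (hv : Continuous v) (hvp : Function.Periodic v (2 * π)) :
    mean (gain g u v) = mean u * mean v := by
  have h1 : mean (gain g u v) =
      mean fun y : ℝ => mean fun x : ℝ => mean fun x' : ℝ =>
        g (x - x' - y / 2) • (u x' * v (x' + y)) :=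
    mean_comm (F := fun x y => mean fun x' : ℝ => g (x - x' - y / 2) • (u x' * v (x' + y)))
      (continuous_inner hg hu hv)
  have h2 : ∀ y : ℝ, (mean fun x : ℝ => mean fun x' : ℝ =>
        g (x - x' - y / 2) • (u x' * v (x' + y))) = mean fun x' : ℝ => u x' * v (x' + y) := by
    intro y
    rw [mean_comm (F := fun x x' => g (x - x' - y / 2) • (u x' * v (x' + y)))
      (by unfold Function.uncurry; fun_prop)]
    congr 1; funext x'
    rw [mean_smul_const (fun x => g (x - x' - y / 2))]
    have := mean_comp_add hgp (-x' - y / 2)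
    rw [hg1] at this
    rw [show (fun x => g (x - x' - y / 2)) = fun x => g (x + (-x' - y / 2)) by
      funext x; congr 1; ring, this, one_smul]
  rw [h1]
  simp only [h2]
  rw [mean_comm (F := fun y x' => u x' * v (x' + y)) (by unfold Function.uncurry; fun_prop)]
  have h3 : ∀ x' : ℝ, (mean fun y : ℝ => u x' * v (x' + y)) = mean v * u x' := by
    intro x'
    rw [mean_const_mul, mul_comm]
    congr 1
    rw [← mean_comp_add hvp x']
    congr 1; funext y; rw [add_comm]
  simp only [h3]
  rw [mean_const_mul, mul_comm]

end gain

/-! ### Linearization at a profile -/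

/-- The space of perturbations: continuous complex functions on the circle with zero mean
(so that the total mass one is kept). -/
def perturbations : Submodule ℂ (ℝ → ℂ) where
  carrier := {h | Continuous h ∧ Function.Periodic h (2 * π) ∧ mean h = 0}
  zero_mem' := ⟨continuous_const, fun _ => rfl, mean_const 0⟩
  add_mem' := by
    rintro u v ⟨hu, hup, hu0⟩ ⟨hv, hvp, hv0⟩
    exact ⟨hu.add hv, hup.add hvp, (mean_add hu hv).trans (by rw [hu0, hv0, add_zero])⟩
  smul_mem' := by
    rintro c u ⟨hu, hup, hu0⟩
    exact ⟨hu.const_smul c, fun x => congrArg (c • ·) (hup x),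
      (mean_const_mul c u).trans (by rw [hu0, mul_zero])⟩

/-- A profile seen as a complex-valued function. -/
def EvenProfile.cplx (f : EvenProfile) : ℝ → ℂ := fun x => (f x : ℂ)

theorem EvenProfile.continuous_cplx (f : EvenProfile) : Continuous f.cplx :=
  Complex.continuous_ofReal.comp f.continuous_toFun

theorem EvenProfile.periodic_cplx (f : EvenProfile) : Function.Periodic f.cplx (2 * π) :=
  fun x => congrArg Complex.ofReal (f.periodic_toFun x)

theorem EvenProfile.even_cplx (f : EvenProfile) : Function.Even f.cplx :=
  fun x => congrArg Complex.ofReal (f.even_toFun x)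

theorem EvenProfile.mean_cplx (f : EvenProfile) : mean f.cplx = 1 := by
  have h := f.mean_toFun
  unfold mean at h ⊢
  have e : (∫ x in (-π)..π, f.cplx x) = ((∫ x in (-π)..π, f x : ℝ) : ℂ) :=
    intervalIntegral.integral_ofReal
  rw [e, Complex.real_smul, ← Complex.ofReal_mul]
  rw [smul_eq_mul] at h
  rw [h, Complex.ofReal_one]

/-- The even perturbations. -/
def evenPerturbations : Submodule ℂ (ℝ → ℂ) where
  carrier := {h | h ∈ perturbations ∧ Function.Even h}
  zero_mem' := ⟨perturbations.zero_mem, fun _ => rfl⟩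
  add_mem' := by
    rintro u v ⟨hu, hue⟩ ⟨hv, hve⟩
    exact ⟨perturbations.add_mem hu hv, fun x => congrArg₂ (· + ·) (hue x) (hve x)⟩
  smul_mem' := by
    rintro c u ⟨hu, hue⟩
    exact ⟨perturbations.smul_mem c hu, fun x => congrArg (c • ·) (hue x)⟩

/-- The derivative at `f`, in direction `h`, of the quadratic gain term `f ↦ gain g f f`. -/
def gainDerivFun (g f : EvenProfile) (h : ℝ → ℂ) (x : ℝ) : ℂ :=
  gain g f.cplx h x + gain g h f.cplx x

theorem gainDerivFun_mem (g f : EvenProfile) :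
    ∀ h ∈ perturbations, gainDerivFun g f h ∈ perturbations := by
  rintro h ⟨hc, hp, h0⟩
  have c1 := continuous_gain g.continuous_toFun f.continuous_cplx hc
  have c2 := continuous_gain g.continuous_toFun hc f.continuous_cplx
  refine ⟨c1.add c2, (periodic_gain g.periodic_toFun).add (periodic_gain g.periodic_toFun), ?_⟩
  refine (mean_add c1 c2).trans ?_
  rw [mean_gain g.continuous_toFun g.periodic_toFun g.mean_toFun f.continuous_cplx hc hp,
    mean_gain g.continuous_toFun g.periodic_toFun g.mean_toFun hc f.continuous_cplx
      f.periodic_cplx, h0, mul_zero, zero_mul, add_zero]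

theorem gainDerivFun_mem_even (g f : EvenProfile) :
    ∀ h ∈ evenPerturbations, gainDerivFun g f h ∈ evenPerturbations := by
  rintro h ⟨hh, he⟩
  exact ⟨gainDerivFun_mem g f h hh,
    (even_gain g.even_toFun f.even_cplx he).add (even_gain g.even_toFun he f.even_cplx)⟩

/-- `gainDerivFun g f` as a linear operator on an invariant space of perturbations. -/
def gainDerivOn (g f : EvenProfile) (V : Submodule ℂ (ℝ → ℂ)) (hV : V ≤ perturbations)
    (hmap : ∀ h ∈ V, gainDerivFun g f h ∈ V) : Module.End ℂ V where
  toFun h := ⟨gainDerivFun g f h.1, hmap h.1 h.2⟩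
  map_add' u v := by
    apply Subtype.ext; funext x
    have e1 := gain_add_right g.continuous_toFun f.continuous_cplx (hV u.2).1 (hV v.2).1 x
    have e2 := gain_add_left g.continuous_toFun f.continuous_cplx (hV u.2).1 (hV v.2).1 x
    change gain g f.cplx (fun t => u.1 t + v.1 t) x + gain g (fun t => u.1 t + v.1 t) f.cplx x
      = (gain g f.cplx u.1 x + gain g u.1 f.cplx x) + (gain g f.cplx v.1 x + gain g v.1 f.cplx x)
    rw [e1, e2]; ring
  map_smul' c u := by
    apply Subtype.ext; funext x
    change gain g f.cplx (fun t => c * u.1 t) x + gain g (fun t => c * u.1 t) f.cplx x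
      = c * (gain g f.cplx u.1 x + gain g u.1 f.cplx x)
    rw [gain_smul_right, gain_smul_left]; ring

/-- The derivative of the gain term at `f`, on all perturbations. -/
def gainDeriv (g f : EvenProfile) : Module.End ℂ perturbations :=
  gainDerivOn g f perturbations le_rfl (gainDerivFun_mem g f)

/-- The derivative of the gain term at `f`, on even perturbations. -/
def evenGainDeriv (g f : EvenProfile) : Module.End ℂ evenPerturbations :=
  gainDerivOn g f evenPerturbations (fun _ h => h.1) (gainDerivFun_mem_even g f)

/-- The generator of the linearized dynamics `∂ₜ h = (linearization g f) h`. As `f` has mass one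
and `h` has mass zero, the loss term contributes `-h`; see `linearization_apply` and
`collision_add`. -/
def linearization (g f : EvenProfile) : Module.End ℂ perturbations := gainDeriv g f - 1

/-- `linearization`, on even perturbations. -/
def evenLinearization (g f : EvenProfile) : Module.End ℂ evenPerturbations :=
  evenGainDeriv g f - 1

theorem mean_translate {u : ℝ → ℂ} (hu : Function.Periodic u (2 * π)) (x : ℝ) :
    (mean fun y : ℝ => u (x + y)) = mean u := by
  rw [← mean_comp_add hu x]
  congr 1; funext y; rw [add_comm]

/-- The linearization is obtained by differentiating each factor of `collision g f`. -/
theorem linearization_apply (g f : EvenProfile) (h : perturbations) (x : ℝ) :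
    (linearization g f h).1 x = gain g f.cplx h.1 x + gain g h.1 f.cplx x
      - (f.cplx x * (mean fun y : ℝ => h.1 (x + y)) + h.1 x * mean fun y : ℝ => f.cplx (x + y)) := by
  rw [mean_translate h.2.2.1, mean_translate f.periodic_cplx, h.2.2.2, f.mean_cplx, mul_zero,
    zero_add, mul_one]
  rfl

/-- The right-hand side of the kinetic equation is quadratic, with linear part `linearization`. -/
theorem collision_add (g f : EvenProfile) (h : perturbations) (x : ℝ) :
    collision g (fun t => f.cplx t + h.1 t) x
      = collision g f.cplx x + (linearization g f h).1 x + collision g h.1 x := by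
  have hf := f.continuous_cplx
  have hh := h.2.1
  have hfh : Continuous fun t => f.cplx t + h.1 t := hf.add hh
  rw [linearization_apply]
  unfold collision
  rw [gain_add_left g.continuous_toFun hfh hf hh,
    gain_add_right g.continuous_toFun hf hf hh, gain_add_right g.continuous_toFun hh hf hh,
    mean_add (u := fun y => f.cplx (x + y)) (v := fun y => h.1 (x + y))
      (by fun_prop) (by fun_prop)]
  ring

/-- Linear stability for `∂ₜ h = L h`: the spectrum of `L` lies in the open left half-plane. -/
def IsStableGenerator {V : Type*} [AddCommGroup V] [Module ℂ V] (L : Module.End ℂ V) : Prop :=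
  ∀ z ∈ spectrum ℂ L, z.re < 0

/-- Linear instability for `∂ₜ h = L h`: there is an eigenvalue with positive real part. -/
def IsUnstableGenerator {V : Type*} [AddCommGroup V] [Module ℂ V] (L : Module.End ℂ V) : Prop :=
  ∃ z : ℂ, L.HasEigenvalue z ∧ 0 < z.re

/-- `r` is the leading eigenvalue of `A`: an eigenvalue, and every other point of the spectrum has
smaller modulus. -/
def IsLeadingEigenvalue {V : Type*} [AddCommGroup V] [Module ℂ V] (A : Module.End ℂ V)
    (r : ℝ) : Prop :=
  A.HasEigenvalue (r : ℂ) ∧ ∀ z ∈ spectrum ℂ A, z ≠ (r : ℂ) → ‖z‖ < r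

/-! ### The uniform profile and the noise family -/

/-- The uniform distribution `f = 1`. -/
def uniform : EvenProfile where
  toFun := fun _ => 1
  continuous_toFun := continuous_const
  periodic_toFun := fun _ => rfl
  even_toFun := fun _ => rfl
  mean_toFun := mean_const 1

theorem mean_cos {k : ℕ} (hk : k ≠ 0) : (mean fun x : ℝ => Real.cos (k * x)) = 0 := by
  have hk' : (k : ℝ) ≠ 0 := by exact_mod_cast hk
  unfold mean
  rw [intervalIntegral.integral_comp_mul_left (fun x => Real.cos x) hk', integral_cos]
  simp [mul_neg, Real.sin_neg, Real.sin_nat_mul_pi]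

/-- The cosine polynomial `1 + 2 c₁ cos x + 2 ∑_{k=2}^N c_k cos kx`. -/
def cosPoly (N : ℕ) (c₁ : ℝ) (c : ℕ → ℝ) : EvenProfile where
  toFun := fun x => 1 + 2 * c₁ * Real.cos x + 2 * ∑ k ∈ Finset.Icc 2 N, c k * Real.cos (k * x)
  continuous_toFun := by fun_prop
  periodic_toFun := by
    intro x
    simp only
    rw [Real.cos_add_two_pi]
    congr 2
    refine Finset.sum_congr rfl fun k _ => ?_
    rw [show (k : ℝ) * (x + 2 * π) = k * x + k * (2 * π) by ring, Real.cos_add_nat_mul_two_pi]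
  even_toFun := by
    intro x
    simp only [mul_neg, Real.cos_neg]
  mean_toFun := by
    have hs : ∀ s : Finset ℕ, 0 ∉ s →
        (mean fun x : ℝ => ∑ k ∈ s, c k * Real.cos (k * x)) = 0 := by
      intro s hs
      induction s using Finset.induction_on with
      | empty => simpa using mean_const (0 : ℝ)
      | insert a s ha ih =>
        simp only [Finset.sum_insert ha]
        rw [mean_add (by fun_prop) (by fun_prop), mean_const_mul,
          ih (fun h => hs (Finset.mem_insert_of_mem h)),
          mean_cos (fun h => hs (h ▸ Finset.mem_insert_self a s)), mul_zero, add_zero]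
    have h1 : (mean fun x : ℝ => Real.cos x) = 0 := by simpa using mean_cos one_ne_zero
    rw [mean_add (by fun_prop) (by fun_prop), mean_add (by fun_prop) (by fun_prop),
      mean_const, mean_const_mul, mean_const_mul, h1, hs _ (by simp)]
    simp

/-- A one-parameter family of noise functions with finitely many Fourier coefficients,
parametrized by the first one: `γ k`, `2 ≤ k ≤ N`, are `C²` functions from `[0,1]` to `[-1,1]`,
and the second coefficient is positive at the critical value `π/4` of the parameter. -/
structure IsNoiseFamily (N : ℕ) (γ : ℕ → ℝ → ℝ) : Prop where
  two_le : 2 ≤ N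
  contDiffOn : ∀ k ∈ Finset.Icc 2 N, ContDiffOn ℝ 2 (γ k) (Set.Icc 0 1)
  mem_Icc : ∀ k ∈ Finset.Icc 2 N, ∀ s ∈ Set.Icc (0 : ℝ) 1, γ k s ∈ Set.Icc (-1 : ℝ) 1
  second_pos : 0 < γ 2 (π / 4)

/-- The noise function `1 + 2 s cos x + 2 ∑_{k=2}^N γ_k(s) cos kx` with first coefficient `s`. -/
def noise (N : ℕ) (γ : ℕ → ℝ → ℝ) (s : ℝ) : EvenProfile := cosPoly N s fun k => γ k s

end CircleAlignment

end

/-! Everything becomes finite-dimensional in Fourier variables. The `n`-th coefficient of the gain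
term is `g_n ∑_k w(n-2k) u_k v_{n-k}`, where `w(m) = sinc(mπ/2)` is `midWeight`. This weight is
even, `w(0) = 1`, it vanishes at nonzero even integers, `w(1) = 2/π`, `w(3) = -2/(3π)`, and `2|w(n)|
≤ 1/2` for `|n| ≥ 2`. Since `g` is a trigonometric polynomial of degree `N`, the linearized gain
term has finite rank, so every nonzero spectral point is an eigenvalue.

At `f = 1` the operator is diagonal with entries `2 g_n w(n)`: the modes `±1` give `4s/π`, all other
nonzero modes at most `1/2` in modulus. Hence the threshold `π/4`.

The branch is found by a Lyapunov–Schmidt reduction. With `a_1 = ε` prescribed, the equations of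
order at least two form a contraction (`norm_branchMap_sub_le`); on its fixed point `a_2 = γ_2 ε²`
exactly, higher even coefficients are `O(ε²)` and odd ones from the third on are `O(ε³)`. With `δ =
s - π/4`, the first equation divided by `ε` becomes the pitchfork equation `(4/π) δ = (4s/(3π)) γ_2
ε² + O(ε⁴)`. The intermediate value theorem solves it between `√δ` and `√(12δ/q)`, `q = γ_2(π/4)`,
and the expansion of `ε` is read off.

For stability, the linearization on even modes is a small perturbation of a diagonal matrix with one
entry near `1` and the others at most `1/2` in modulus. A determinant sign change gives a real
eigenvalue in `[3/4, 5/4]`; a resolvent estimate shows that no other spectral point has modulus at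
least `3/4` (`IsEigenCoeff.unique`). Eliminating the second mode yields `r = 1 + d - P(2/r + 1) +
O(ε³)` with `d = 4δ/π` and `P = (4s/(3π)) γ_2 ε²`. The pitchfork equation says `P = d + O(ε⁴)`, so
`r = 1 + d - 3d + O(ε³) = 1 - 8δ/π + O(δ^{3/2})`, which is below `1`. -/

namespace CircleAlignment

/-! ### Exponential modes and Fourier coefficients -/

/-- The exponential `x ↦ exp(irx)`. -/
noncomputable def expMode (r x : ℝ) : ℂ := Complex.exp (r * x * Complex.I)

theorem expMode_add_freq (r t x : ℝ) : expMode (r + t) x = expMode r x * expMode t x := by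
  unfold expMode; rw [← Complex.exp_add]; push_cast; ring_nf

theorem expMode_add (r x y : ℝ) : expMode r (x + y) = expMode r x * expMode r y := by
  unfold expMode; rw [← Complex.exp_add]; push_cast; ring_nf

theorem expMode_smul (r t x : ℝ) : expMode r (t * x) = expMode (r * t) x := by
  unfold expMode; push_cast; ring_nf

theorem expMode_neg (r x : ℝ) : expMode r (-x) = expMode (-r) x := by
  unfold expMode; push_cast; ring_nf

@[simp] theorem expMode_zero (x : ℝ) : expMode 0 x = 1 := by simp [expMode]

@[fun_prop] theorem continuous_expMode (r : ℝ) : Continuous (expMode r) := by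
  unfold expMode; fun_prop

theorem periodic_expMode (n : ℤ) : Function.Periodic (expMode n) (2 * π) := by
  intro x
  rw [expMode_add]
  have : expMode n (2 * π) = 1 := by
    unfold expMode
    rw [Complex.exp_eq_one_iff]
    exact ⟨n, by push_cast; ring⟩
  rw [this, mul_one]

theorem expMode_add_neg (r x : ℝ) : expMode r x + expMode (-r) x = 2 * (Real.cos (r * x) : ℂ) := by
  rw [Complex.ofReal_cos, Complex.two_cos]
  unfold expMode; push_cast; ring_nf

/-- The mean of `exp(imy/2)`: the weight `sin(mπ/2)/(mπ/2)`. -/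
noncomputable def midWeight (m : ℤ) : ℝ := Real.sinc (m * π / 2)

theorem mean_expMode_half (m : ℤ) : mean (expMode (m / 2)) = (midWeight m : ℂ) := by
  unfold midWeight
  rcases eq_or_ne m 0 with rfl | hm
  · simp only [Int.cast_zero, zero_div, zero_mul, Real.sinc_zero]
    rw [show expMode 0 = fun _ => (1 : ℂ) from funext expMode_zero, mean_const]; simp
  · have hm' : (m : ℝ) ≠ 0 := by exact_mod_cast hm
    have hc : ((m : ℂ) / 2 * Complex.I) ≠ 0 := by
      simp [hm]
    have hp : (π : ℂ) ≠ 0 := by exact_mod_cast pi_ne_zero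
    have e : (fun x : ℝ => expMode (m / 2) x)
        = fun x : ℝ => Complex.exp ((m : ℂ) / 2 * Complex.I * x) := by
      funext x; unfold expMode; push_cast; ring_nf
    unfold mean
    rw [e, integral_exp_mul_complex hc, Real.sinc_of_ne_zero (by positivity), Complex.real_smul]
    push_cast
    rw [Complex.sin]
    have h1 : (m : ℂ) / 2 * Complex.I * π = m * π / 2 * Complex.I := by ring
    have h2 : (m : ℂ) / 2 * Complex.I * -π = -(m * π / 2) * Complex.I := by ring
    have hmc : (m : ℂ) ≠ 0 := by exact_mod_cast hm
    rw [h1, h2]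
    field_simp
    rw [Complex.I_sq]; ring

theorem midWeight_neg (m : ℤ) : midWeight (-m) = midWeight m := by
  unfold midWeight; rw [← Real.sinc_neg]; push_cast; ring_nf

@[simp] theorem midWeight_zero : midWeight 0 = 1 := by simp [midWeight]

theorem abs_midWeight_le_one (m : ℤ) : |midWeight m| ≤ 1 := Real.abs_sinc_le_one _

theorem midWeight_two_mul {m : ℤ} (hm : m ≠ 0) : midWeight (2 * m) = 0 := by
  unfold midWeight
  rw [show ((2 * m : ℤ) : ℝ) * π / 2 = m * π by push_cast; ring, Real.sinc_of_ne_zero,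
    Real.sin_int_mul_pi, zero_div]
  exact mul_ne_zero (by exact_mod_cast hm) pi_ne_zero

theorem midWeight_one : midWeight 1 = 2 / π := by
  unfold midWeight
  rw [Int.cast_one, one_mul, Real.sinc_of_ne_zero (by positivity), Real.sin_pi_div_two]
  field_simp

theorem midWeight_three : midWeight 3 = -(2 / (3 * π)) := by
  unfold midWeight
  rw [Real.sinc_of_ne_zero (by positivity),
    show ((3 : ℤ) : ℝ) * π / 2 = π / 2 + π by push_cast; ring, Real.sin_add_pi, Real.sin_pi_div_two]
  field_simp; ring

/-- This is the gap separating the modes `±1` from all higher ones; both the contraction and the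
resolvent estimate rest on it. Even `n` give zero, and for odd `|n| ≥ 3` the denominator `|nπ/2|`
exceeds `4`. -/
theorem two_mul_abs_midWeight_le {n : ℤ} (hn : 2 ≤ |n|) : 2 * |midWeight n| ≤ 1 / 2 := by
  rcases Int.even_or_odd' n with ⟨k, rfl | rfl⟩
  · rw [midWeight_two_mul (by rintro rfl; simp at hn)]; norm_num
  · have h3 : 3 ≤ |2 * k + 1| := by grind
    have h3' : (3 : ℝ) ≤ |((2 * k + 1 : ℤ) : ℝ)| := by exact_mod_cast h3
    set t : ℝ := ((2 * k + 1 : ℤ) : ℝ) with ht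
    have ht0 : t ≠ 0 := by intro h; rw [h] at h3'; norm_num at h3'
    unfold midWeight
    rw [← ht, Real.sinc_of_ne_zero (by positivity), abs_div]
    have hpi := pi_gt_three
    have hden : (4 : ℝ) ≤ |t * π / 2| := by
      rw [abs_div, abs_mul, abs_of_pos pi_pos, abs_of_pos (by norm_num : (0 : ℝ) < 2)]
      nlinarith
    have := Real.abs_sin_le_one (t * π / 2)
    rw [← mul_div_assoc, div_le_iff₀ (by linarith)]
    linarith

theorem mean_expMode (n : ℤ) : mean (expMode n) = if n = 0 then 1 else 0 := by
  have h := mean_expMode_half (2 * n)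
  rw [show ((2 * n : ℤ) : ℝ) / 2 = n by push_cast; ring] at h
  rw [h]
  split_ifs with h0
  · subst h0; simp
  · rw [midWeight_two_mul h0, Complex.ofReal_zero]

theorem mean_sum {ι 𝕜 : Type*} [RCLike 𝕜] (s : Finset ι) (F : ι → ℝ → 𝕜)
    (hF : ∀ i ∈ s, Continuous (F i)) :
    mean (fun x => ∑ i ∈ s, F i x) = ∑ i ∈ s, mean (F i) := by
  unfold mean
  rw [intervalIntegral.integral_finsetSum fun i hi => (hF i hi).intervalIntegrable _ _,
    Finset.smul_sum]

theorem mean_ofReal (u : ℝ → ℝ) : mean (fun x => (u x : ℂ)) = ((mean u : ℝ) : ℂ) := by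
  unfold mean
  rw [intervalIntegral.integral_ofReal, Complex.real_smul, smul_eq_mul]
  push_cast; rfl

/-- The `n`-th Fourier coefficient of a function on the circle. -/
noncomputable def fourierExp (h : ℝ → ℂ) (n : ℤ) : ℂ := mean fun x => expMode (-n) x * h x

theorem fourierExp_zero (h : ℝ → ℂ) : fourierExp h 0 = mean h := by simp [fourierExp]

theorem fourierExp_neg {h : ℝ → ℂ} (he : Function.Even h) (n : ℤ) :
    fourierExp h (-n) = fourierExp h n := by
  unfold fourierExp
  rw [← mean_comp_neg]
  congr 1; funext x
  rw [he, expMode_neg]; push_cast; rw [neg_neg]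

/-- The trigonometric polynomial `∑_{k ∈ s} c_k exp(ikx)`. -/
noncomputable def trigPoly (s : Finset ℤ) (c : ℤ → ℂ) (x : ℝ) : ℂ := ∑ k ∈ s, c k * expMode k x

@[fun_prop] theorem continuous_trigPoly (s : Finset ℤ) (c : ℤ → ℂ) : Continuous (trigPoly s c) := by
  unfold trigPoly; fun_prop

theorem periodic_trigPoly (s : Finset ℤ) (c : ℤ → ℂ) :
    Function.Periodic (trigPoly s c) (2 * π) := fun x =>
  Finset.sum_congr rfl fun k _ => by rw [periodic_expMode k x]

theorem fourierExp_trigPoly (s : Finset ℤ) (c : ℤ → ℂ) (n : ℤ) :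
    fourierExp (trigPoly s c) n = if n ∈ s then c n else 0 := by
  unfold fourierExp trigPoly
  simp only [Finset.mul_sum]
  rw [mean_sum _ _ fun k _ => by fun_prop]
  have : ∀ k : ℤ, (mean fun x => expMode (-n) x * (c k * expMode k x))
      = if k = n then c k else 0 := by
    intro k
    have e : (fun x => expMode (-n) x * (c k * expMode k x))
        = fun x => c k * expMode ((k - n : ℤ) : ℝ) x := by
      funext x; rw [Int.cast_sub, sub_eq_add_neg, expMode_add_freq]; ring
    rw [e, mean_const_mul, mean_expMode]
    by_cases h : k = n
    · simp [h]
    · rw [if_neg h, if_neg (by omega), mul_zero]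
  simp only [this, Finset.sum_ite_eq']

/-! ### The gain term in Fourier variables -/

/-- The coefficient by which the `n`-th mode of the noise is multiplied in `gain g u v`. -/
noncomputable def gainCoeff (n : ℤ) (u v : ℝ → ℂ) : ℂ :=
  mean fun y : ℝ => mean fun x' : ℝ => expMode (-n) (x' + y / 2) * (u x' * v (x' + y))

theorem continuous_gainCoeff_slice (n : ℤ) {u v : ℝ → ℂ} (hu : Continuous u) (hv : Continuous v) :
    Continuous fun y : ℝ =>
      mean fun x' : ℝ => expMode (-n) (x' + y / 2) * (u x' * v (x' + y)) :=
  continuous_mean (F := fun y x' => expMode (-n) (x' + y / 2) * (u x' * v (x' + y)))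
    (by unfold Function.uncurry; fun_prop)

/-- Each exponential of the noise splits as a function of `x` times a function of the midpoint `x' +
y/2`, so only finitely many modes in `x` survive. -/
theorem gain_eq_trigPoly {g : ℝ → ℝ} {s : Finset ℤ} {c : ℤ → ℂ}
    (hg : ∀ x, (g x : ℂ) = trigPoly s c x) {u v : ℝ → ℂ} (hu : Continuous u) (hv : Continuous v)
    (x : ℝ) : gain g u v x = trigPoly s (fun n => c n * gainCoeff n u v) x := by
  have e1 : ∀ y : ℝ, (mean fun x' : ℝ => g (x - x' - y / 2) • (u x' * v (x' + y)))
      = ∑ n ∈ s, (c n * expMode n x) *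
          mean fun x' : ℝ => expMode (-n) (x' + y / 2) * (u x' * v (x' + y)) := by
    intro y
    simp only [← mean_const_mul]
    rw [← mean_sum _ _ fun n _ => by fun_prop]
    congr 1; funext x'
    rw [Complex.real_smul, hg, trigPoly, Finset.sum_mul]
    refine Finset.sum_congr rfl fun n _ => ?_
    rw [show x - x' - y / 2 = x + -(x' + y / 2) by ring, expMode_add, expMode_neg]
    ring
  unfold gain
  simp only [e1]
  rw [mean_sum _ _ fun n _ => (continuous_gainCoeff_slice n hu hv).const_mul _]
  unfold trigPoly
  refine Finset.sum_congr rfl fun n _ => ?_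
  rw [mean_const_mul]
  unfold gainCoeff
  ring

/-- The phase `-n(x' + y/2) + kx'` equals `-(n-k)(x' + y) + (n-2k)y/2`. Shifting `x'` by `y`, which
needs periodicity, decouples the two means; the mean in `y` over half-integer frequencies produces
the weight. -/
theorem gainCoeff_expMode_left (n k : ℤ) {v : ℝ → ℂ}
    (hvp : Function.Periodic v (2 * π)) :
    gainCoeff n (expMode k) v = midWeight (n - 2 * k) * fourierExp v (n - k) := by
  have e : ∀ y : ℝ, (mean fun x' : ℝ => expMode (-n) (x' + y / 2) * (expMode k x' * v (x' + y)))
      = fourierExp v (n - k) * expMode (((n - 2 * k : ℤ) : ℝ) / 2) y := by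
    intro y
    have hp : Function.Periodic (fun w => expMode (-((n - k : ℤ) : ℝ)) w * v w) (2 * π) := by
      have := periodic_expMode (-(n - k))
      rw [Int.cast_neg] at this
      exact this.mul hvp
    unfold fourierExp
    rw [← mean_comp_add hp y, mul_comm, ← mean_const_mul]
    congr 1; funext x'
    rw [expMode_add, expMode_add, div_eq_inv_mul, expMode_smul]
    have h1 : expMode (-((n - k : ℤ) : ℝ)) x' = expMode (-n) x' * expMode k x' := by
      rw [← expMode_add_freq]; push_cast; ring_nf
    have h2 : expMode (-n * 2⁻¹) y
        = expMode (((n - 2 * k : ℤ) : ℝ) / 2) y * expMode (-((n - k : ℤ) : ℝ)) y := by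
      rw [← expMode_add_freq]; push_cast; ring_nf
    rw [h1, h2]; ring
  unfold gainCoeff
  simp only [e]
  rw [mean_const_mul, mean_expMode_half, mul_comm]

theorem gainCoeff_expMode_right (n k : ℤ) {u : ℝ → ℂ} :
    gainCoeff n u (expMode k) = midWeight (n - 2 * k) * fourierExp u (n - k) := by
  have e : ∀ y : ℝ, (mean fun x' : ℝ => expMode (-n) (x' + y / 2) * (u x' * expMode k (x' + y)))
      = fourierExp u (n - k) * expMode (((-(n - 2 * k) : ℤ) : ℝ) / 2) y := by
    intro y
    unfold fourierExp
    rw [mul_comm, ← mean_const_mul]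
    congr 1; funext x'
    rw [expMode_add, expMode_add, div_eq_inv_mul, expMode_smul]
    have h1 : expMode (-((n - k : ℤ) : ℝ)) x' = expMode (-n) x' * expMode k x' := by
      rw [← expMode_add_freq]; push_cast; ring_nf
    have h2 : expMode (((-(n - 2 * k) : ℤ) : ℝ) / 2) y = expMode (-n * 2⁻¹) y * expMode k y := by
      rw [← expMode_add_freq]; push_cast; ring_nf
    rw [h1, h2]; ring
  unfold gainCoeff
  simp only [e]
  rw [mean_const_mul, mean_expMode_half, mul_comm, midWeight_neg]

theorem gainCoeff_trigPoly_left (n : ℤ) (s : Finset ℤ) (c : ℤ → ℂ) {v : ℝ → ℂ}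
    (hv : Continuous v) (hvp : Function.Periodic v (2 * π)) :
    gainCoeff n (trigPoly s c) v
      = ∑ k ∈ s, midWeight (n - 2 * k) * (c k * fourierExp v (n - k)) := by
  have e : gainCoeff n (trigPoly s c) v = ∑ k ∈ s, c k * gainCoeff n (expMode k) v := by
    unfold gainCoeff
    simp only [← mean_const_mul]
    rw [← mean_sum _ _ fun k _ => by
      simp only [mean_const_mul]
      exact (continuous_gainCoeff_slice n (continuous_expMode k) hv).const_mul _]
    congr 1; funext y
    rw [← mean_sum _ _ fun k _ => by fun_prop]
    congr 1; funext x'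
    unfold trigPoly
    rw [Finset.sum_mul, Finset.mul_sum]
    exact Finset.sum_congr rfl fun k _ => by ring
  rw [e]
  exact Finset.sum_congr rfl fun k _ => by rw [gainCoeff_expMode_left n k hvp]; ring

theorem gainCoeff_trigPoly_right (n : ℤ) (s : Finset ℤ) (c : ℤ → ℂ) {u : ℝ → ℂ}
    (hu : Continuous u) :
    gainCoeff n u (trigPoly s c)
      = ∑ k ∈ s, midWeight (n - 2 * k) * (c k * fourierExp u (n - k)) := by
  have e : gainCoeff n u (trigPoly s c) = ∑ k ∈ s, c k * gainCoeff n u (expMode k) := by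
    unfold gainCoeff
    simp only [← mean_const_mul]
    rw [← mean_sum _ _ fun k _ => by
      simp only [mean_const_mul]
      exact (continuous_gainCoeff_slice n hu (continuous_expMode k)).const_mul _]
    congr 1; funext y
    rw [← mean_sum _ _ fun k _ => by fun_prop]
    congr 1; funext x'
    unfold trigPoly
    rw [Finset.mul_sum, Finset.mul_sum]
    exact Finset.sum_congr rfl fun k _ => by ring
  rw [e]
  exact Finset.sum_congr rfl fun k _ => by rw [gainCoeff_expMode_right n k]; ring

theorem ofReal_gain (g u v : ℝ → ℝ) (x : ℝ) :
    ((gain g u v x : ℝ) : ℂ) = gain g (fun t => (u t : ℂ)) (fun t => (v t : ℂ)) x := by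
  unfold gain
  rw [← mean_ofReal]
  congr 1; funext y
  rw [← mean_ofReal]
  congr 1; funext x'
  rw [Complex.real_smul, smul_eq_mul]
  push_cast; rfl

/-! ### Cosine polynomials as profiles -/

/-- The Fourier coefficients of `cosPoly N c₁ c`, indexed by all integers. -/
noncomputable def cosCoeff (N : ℕ) (c₁ : ℝ) (c : ℕ → ℝ) (k : ℤ) : ℝ :=
  if k.natAbs = 0 then 1 else if k.natAbs = 1 then c₁ else if k.natAbs ≤ N then c k.natAbs else 0

section cosCoeff

variable {N : ℕ} {c₁ : ℝ} {c : ℕ → ℝ}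

@[simp] theorem cosCoeff_zero : cosCoeff N c₁ c 0 = 1 := by simp [cosCoeff]

@[simp] theorem cosCoeff_one : cosCoeff N c₁ c 1 = c₁ := by simp [cosCoeff]

theorem cosCoeff_neg (k : ℤ) : cosCoeff N c₁ c (-k) = cosCoeff N c₁ c k := by
  simp [cosCoeff]

theorem cosCoeff_of_two_le {k : ℤ} (h2 : 2 ≤ k) (hN : k ≤ N) :
    cosCoeff N c₁ c k = c k.natAbs := by
  unfold cosCoeff
  rw [if_neg (by omega), if_neg (by omega), if_pos (by omega)]

theorem cosCoeff_of_lt {k : ℤ} (h2 : 2 ≤ N) (hN : (N : ℤ) < |k|) : cosCoeff N c₁ c k = 0 := by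
  unfold cosCoeff
  rw [if_neg (by grind), if_neg (by grind), if_neg (by grind)]

theorem sum_Icc_natAbs_mul_expMode (a : ℕ → ℂ) (N : ℕ) (x : ℝ) :
    ∑ k ∈ Finset.Icc (-(N : ℤ)) N, a k.natAbs * expMode k x
      = a 0 + 2 * ∑ k ∈ Finset.Icc 1 N, a k * (Real.cos (k * x) : ℂ) := by
  induction N with
  | zero => simp
  | succ N ih =>
    have e : Finset.Icc (-((N + 1 : ℕ) : ℤ)) ((N + 1 : ℕ) : ℤ)
        = insert (-((N + 1 : ℕ) : ℤ)) (insert ((N + 1 : ℕ) : ℤ) (Finset.Icc (-(N : ℤ)) N)) := by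
      ext k; simp only [Finset.mem_Icc, Finset.mem_insert]; omega
    rw [e, Finset.sum_insert, Finset.sum_insert, ih, ← Finset.insert_Icc_right_eq_Icc_add_one (by omega),
      Finset.sum_insert]
    · have := expMode_add_neg ((N + 1 : ℕ) : ℝ) x
      rw [Int.natAbs_neg, Int.natAbs_natCast]
      push_cast at this ⊢
      linear_combination a (N + 1) * this
    · simp
    · simp
    · simp only [Finset.mem_insert, Finset.mem_Icc]; omega

theorem cosPoly_cplx (h2 : 2 ≤ N) (x : ℝ) :
    (cosPoly N c₁ c).cplx x
      = trigPoly (Finset.Icc (-(N : ℤ)) N) (fun k => (cosCoeff N c₁ c k : ℂ)) x := by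
  have h := sum_Icc_natAbs_mul_expMode (fun k => ((cosCoeff N c₁ c (k : ℤ) : ℝ) : ℂ)) N x
  have e : ∀ k : ℤ, cosCoeff N c₁ c (k.natAbs : ℤ) = cosCoeff N c₁ c k := by
    intro k; unfold cosCoeff; rw [Int.natAbs_natCast]
  simp only [e] at h
  unfold trigPoly
  rw [h, ← Finset.add_sum_Ioc_eq_sum_Icc (by omega : 1 ≤ N)]
  have e2 : ∀ k ∈ Finset.Ioc 1 N, ((cosCoeff N c₁ c (k : ℤ) : ℝ) : ℂ) * (Real.cos (k * x) : ℂ)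
      = ((c k * Real.cos (k * x) : ℝ) : ℂ) := by
    intro k hk
    rw [Finset.mem_Ioc] at hk
    rw [cosCoeff_of_two_le (by omega) (by omega)]
    push_cast; rfl
  rw [Finset.sum_congr rfl e2]
  simp only [EvenProfile.cplx, cosPoly]
  rw [show Finset.Icc 2 N = Finset.Ioc 1 N from rfl]
  push_cast
  simp; ring

theorem fourierExp_cosPoly (h2 : 2 ≤ N) (n : ℤ) :
    fourierExp (cosPoly N c₁ c).cplx n = cosCoeff N c₁ c n := by
  rw [funext (cosPoly_cplx h2), fourierExp_trigPoly]
  split_ifs with h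
  · rfl
  · rw [cosCoeff_of_lt h2]; · simp
    rw [Finset.mem_Icc] at h; grind

theorem ofReal_fourierCos (f : EvenProfile) (k : ℕ) :
    ((fourierCos f k : ℝ) : ℂ) = fourierExp f.cplx k := by
  have h : fourierExp f.cplx k = (1 / 2 : ℂ) * (fourierExp f.cplx k + fourierExp f.cplx (-k)) := by
    rw [fourierExp_neg f.even_cplx]; ring
  have hc := f.continuous_cplx
  rw [h]
  unfold fourierExp
  rw [← mean_add (by fun_prop) (by fun_prop), ← mean_const_mul]
  unfold fourierCos
  rw [← mean_ofReal]
  congr 1; funext x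
  have := expMode_add_neg (k : ℝ) x
  unfold EvenProfile.cplx
  push_cast at this ⊢
  rw [neg_neg]
  linear_combination (-(1 / 2) * (f.toFun x : ℂ)) * this

theorem fourierCos_cosPoly (h2 : 2 ≤ N) (k : ℕ) :
    fourierCos (cosPoly N c₁ c) k = cosCoeff N c₁ c k := by
  have h := ofReal_fourierCos (cosPoly N c₁ c) k
  rw [fourierExp_cosPoly h2] at h
  exact_mod_cast h

end cosCoeff

end CircleAlignment

namespace CircleAlignment

/-! ### The quadratic form of the gain term on Fourier coefficients -/

section modeSum

variable {E : Type*} [NormedAddCommGroup E] [NormedSpace ℝ E]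

/-- The `n`-th Fourier coefficient of the gain term, before multiplication by the noise. -/
noncomputable def modeSum (N : ℕ) (A : ℤ → ℝ) (H : ℤ → E) (n : ℤ) : E :=
  ∑ k ∈ Finset.Icc (-(N : ℤ)) N, (midWeight (n - 2 * k) * A k) • H (n - k)

/-- Thanks to this symmetry, systems for even functions need only be imposed for `n ≥ 1`. -/
theorem modeSum_neg {N : ℕ} {A : ℤ → ℝ} {H : ℤ → E} (hA : ∀ k, A (-k) = A k)
    (hH : ∀ k, H (-k) = H k) (n : ℤ) : modeSum N A H (-n) = modeSum N A H n := by
  unfold modeSum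
  refine Finset.sum_nbij' (fun k => -k) (fun k => -k) ?_ ?_ ?_ ?_ ?_
  · intro k hk; simp only [Finset.mem_Icc] at *; omega
  · intro k hk; simp only [Finset.mem_Icc] at *; omega
  · simp
  · simp
  · intro k _
    rw [hA, ← midWeight_neg, ← hH]
    congr 3 <;> ring

/-- The weight vanishes at nonzero even integers, so only `k = m` contributes. The case `m = 0` is
conservation of mass; `m = 1` gives the exact second-order relations used in both expansions. -/
theorem modeSum_two_mul (N : ℕ) (A : ℤ → ℝ) (H : ℤ → E) {m : ℤ} (hm : |m| ≤ N) :
    modeSum N A H (2 * m) = A m • H m := by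
  unfold modeSum
  rw [Finset.sum_eq_single m]
  · rw [sub_self, midWeight_zero, one_mul]; congr 2; ring
  · intro k _ hk
    rw [← mul_sub, midWeight_two_mul (by omega), zero_mul, zero_smul]
  · intro h; exact absurd (Finset.mem_Icc.2 (abs_le.1 hm)) h

theorem modeSum_at_zero (N : ℕ) (A : ℤ → ℝ) (H : ℤ → E) : modeSum N A H 0 = A 0 • H 0 := by
  simpa using modeSum_two_mul N A H (m := 0) (by simp)

theorem ofReal_modeSum (N : ℕ) (A H : ℤ → ℝ) (n : ℤ) :
    ((modeSum N A H n : ℝ) : ℂ) = modeSum N A (fun k => (H k : ℂ)) n := by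
  unfold modeSum; push_cast
  exact Finset.sum_congr rfl fun k _ => by rw [Complex.real_smul]; simp

end modeSum

section cosPoly

variable {N : ℕ} {g₁ c₁ : ℝ} {g c : ℕ → ℝ}

theorem gainCoeff_cosPoly_left (h2 : 2 ≤ N) (n : ℤ) {h : ℝ → ℂ} (hc : Continuous h)
    (hp : Function.Periodic h (2 * π)) :
    gainCoeff n (cosPoly N c₁ c).cplx h = modeSum N (cosCoeff N c₁ c) (fourierExp h) n := by
  rw [funext (cosPoly_cplx h2), gainCoeff_trigPoly_left n _ _ hc hp]
  exact Finset.sum_congr rfl fun k _ => by rw [Complex.real_smul]; push_cast; ring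

theorem gainCoeff_cosPoly_right (h2 : 2 ≤ N) (n : ℤ) {h : ℝ → ℂ} (hc : Continuous h) :
    gainCoeff n h (cosPoly N c₁ c).cplx = modeSum N (cosCoeff N c₁ c) (fourierExp h) n := by
  rw [funext (cosPoly_cplx h2), gainCoeff_trigPoly_right n _ _ hc]
  exact Finset.sum_congr rfl fun k _ => by rw [Complex.real_smul]; push_cast; ring

/-- The factor `2` appears because the two orders of the arguments have the same mode sums, the
weight being even. -/
theorem gainDerivFun_cosPoly (h2 : 2 ≤ N) {h : ℝ → ℂ} (hh : h ∈ perturbations) :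
    gainDerivFun (cosPoly N g₁ g) (cosPoly N c₁ c) h
      = trigPoly (Finset.Icc (-(N : ℤ)) N) fun n =>
          2 * cosCoeff N g₁ g n * modeSum N (cosCoeff N c₁ c) (fourierExp h) n := by
  funext x
  have hf := (cosPoly N c₁ c).continuous_cplx
  unfold gainDerivFun
  rw [gain_eq_trigPoly (cosPoly_cplx h2) hf hh.1, gain_eq_trigPoly (cosPoly_cplx h2) hh.1 hf]
  unfold trigPoly
  rw [← Finset.sum_add_distrib]
  refine Finset.sum_congr rfl fun n _ => ?_
  beta_reduce
  rw [gainCoeff_cosPoly_left h2 n hh.1 hh.2.1, gainCoeff_cosPoly_right h2 n hh.1]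
  ring

/-- Stationarity is a system of quadratic equations on the Fourier coefficients. -/
theorem isStationary_cosPoly (h2 : 2 ≤ N)
    (hc : ∀ n : ℤ, 1 ≤ n → n ≤ N → cosCoeff N c₁ c n
      = cosCoeff N g₁ g n * modeSum N (cosCoeff N c₁ c) (cosCoeff N c₁ c) n) :
    IsStationary (cosPoly N g₁ g) (cosPoly N c₁ c) := by
  intro x
  set f := cosPoly N c₁ c with hf
  set A := cosCoeff N c₁ c with hA
  have hfc := f.continuous_cplx
  have h1 : (mean fun y : ℝ => f (x + y)) = 1 := by
    rw [← f.mean_toFun, ← mean_comp_add f.periodic_toFun x]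
    congr 1; funext y; rw [add_comm]
  -- Negative orders follow by evenness, and order zero is conservation of mass.
  have key : ∀ n ∈ Finset.Icc (-(N : ℤ)) N, A n = cosCoeff N g₁ g n * modeSum N A A n := by
    intro n hn
    rw [Finset.mem_Icc] at hn
    rcases lt_trichotomy n 0 with h | h | h
    · have := hc (-n) (by omega) (by omega)
      rwa [modeSum_neg cosCoeff_neg cosCoeff_neg, hA, cosCoeff_neg, cosCoeff_neg] at this
    · subst h; rw [modeSum_at_zero, hA]; simp
    · exact hc n (by omega) hn.2
  have hgain : gain (cosPoly N g₁ g) f.cplx f.cplx x = f.cplx x := by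
    rw [gain_eq_trigPoly (cosPoly_cplx h2) hfc hfc]
    refine Eq.trans ?_ (cosPoly_cplx h2 x).symm
    unfold trigPoly
    refine Finset.sum_congr rfl fun n hn => ?_
    beta_reduce
    rw [gainCoeff_cosPoly_left h2 n hfc f.periodic_cplx, ← hA]
    rw [show fourierExp f.cplx = fun k => ((A k : ℝ) : ℂ) from funext (fourierExp_cosPoly h2),
      ← ofReal_modeSum, ← Complex.ofReal_mul, ← key n hn]
  unfold collision
  rw [h1, mul_one, sub_eq_zero]
  have := ofReal_gain (cosPoly N g₁ g) f f x
  rw [show (fun t => ((f t : ℝ) : ℂ)) = f.cplx from rfl, hgain] at this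
  exact Complex.ofReal_injective this

end cosPoly

/-! ### Spectra of operators of finite rank -/

/-- If `z ≠ 0` is not an eigenvalue, `z - T` is injective and preserves the finite-dimensional range
of `T`, hence is onto there. Choosing `w` in the range with `(z - T)w = Tv`, the vector `z⁻¹(v + w)`
is a preimage of `v`. The argument is algebraic and needs no topology on `V`. -/
theorem hasEigenvalue_of_mem_spectrum_of_finiteDimensional_range {K V : Type*} [Field K]
    [AddCommGroup V] [Module K V] (T : Module.End K V) [FiniteDimensional K (LinearMap.range T)]
    {z : K} (hz : z ≠ 0) (hs : z ∈ spectrum K T) : T.HasEigenvalue z := by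
  by_contra hne
  have hinj : Function.Injective (algebraMap K (Module.End K V) z - T) := by
    rw [← LinearMap.ker_eq_bot, LinearMap.ker_eq_bot']
    intro v hv
    by_contra hv0
    refine hne (Module.End.hasEigenvalue_of_hasEigenvector (x := v) ⟨?_, hv0⟩)
    rw [Module.End.mem_eigenspace_iff]
    simp only [LinearMap.sub_apply, Module.algebraMap_end_apply] at hv
    exact (sub_eq_zero.1 hv).symm
  refine hs ?_
  change IsUnit _
  rw [Module.End.isUnit_iff]
  refine ⟨hinj, fun v => ?_⟩
  set W := LinearMap.range T
  have hW : ∀ w ∈ W, (algebraMap K (Module.End K V) z - T) w ∈ W := fun w hw => by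
    simp only [LinearMap.sub_apply, Module.algebraMap_end_apply]
    exact W.sub_mem (W.smul_mem z hw) ⟨w, rfl⟩
  have hsurj : Function.Surjective ((algebraMap K (Module.End K V) z - T).restrict hW) := by
    rw [← LinearMap.injective_iff_surjective]
    intro a b hab
    exact Subtype.ext (hinj (congrArg Subtype.val hab))
  obtain ⟨w, hw⟩ := hsurj ⟨T v, v, rfl⟩
  have hw' : z • w.1 - T w.1 = T v := by
    have := congrArg Subtype.val hw
    simpa [Module.algebraMap_end_apply] using this
  refine ⟨z⁻¹ • (v + w.1), ?_⟩
  rw [map_smul, inv_smul_eq_iff₀ hz]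
  simp only [LinearMap.sub_apply, Module.algebraMap_end_apply, map_add]
  rw [← hw']
  abel

section spectrum

variable {N : ℕ} {g₁ c₁ : ℝ} {g c : ℕ → ℝ} {V : Submodule ℂ (ℝ → ℂ)}

theorem finiteDimensional_range_gainDerivOn (h2 : 2 ≤ N) (hV : V ≤ perturbations)
    (hmap : ∀ h ∈ V, gainDerivFun (cosPoly N g₁ g) (cosPoly N c₁ c) h ∈ V) :
    FiniteDimensional ℂ
      (LinearMap.range (gainDerivOn (cosPoly N g₁ g) (cosPoly N c₁ c) V hV hmap)) := by
  set T := gainDerivOn (cosPoly N g₁ g) (cosPoly N c₁ c) V hV hmap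
  set S : Submodule ℂ (ℝ → ℂ) := Submodule.span ℂ
    ((fun n : ℤ => expMode n) '' (Finset.Icc (-(N : ℤ)) N : Finset ℤ))
  have hS : FiniteDimensional ℂ S :=
    FiniteDimensional.span_of_finite ℂ ((Finset.finite_toSet _).image _)
  have hle : (LinearMap.range T).map V.subtype ≤ S := by
    rintro _ ⟨_, ⟨h, rfl⟩, rfl⟩
    change gainDerivFun (cosPoly N g₁ g) (cosPoly N c₁ c) h.1 ∈ S
    rw [gainDerivFun_cosPoly h2 (hV h.2)]
    have e : ∀ a : ℤ → ℂ, trigPoly (Finset.Icc (-(N : ℤ)) N) a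
        = ∑ k ∈ Finset.Icc (-(N : ℤ)) N, a k • expMode k := by
      intro a; funext x; simp [trigPoly]
    rw [e]
    exact S.sum_mem fun k hk => S.smul_mem _ (Submodule.subset_span ⟨k, hk, rfl⟩)
  have := Submodule.finiteDimensional_of_le hle
  exact Module.Finite.equiv (Submodule.equivSubtypeMap V (LinearMap.range T)).symm

/-- The nonzero spectrum of the linearized gain term is described by the Fourier coefficients of
eigenfunctions. -/
theorem exists_fourierExp_of_mem_spectrum (h2 : 2 ≤ N) (hV : V ≤ perturbations)
    (hmap : ∀ h ∈ V, gainDerivFun (cosPoly N g₁ g) (cosPoly N c₁ c) h ∈ V) {z : ℂ} (hz : z ≠ 0)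
    (hs : z ∈ spectrum ℂ (gainDerivOn (cosPoly N g₁ g) (cosPoly N c₁ c) V hV hmap)) :
    ∃ h ∈ V, (∀ n : ℤ, (N : ℤ) < |n| → fourierExp h n = 0) ∧
      (∀ n : ℤ, |n| ≤ N → z * fourierExp h n
        = 2 * cosCoeff N g₁ g n * modeSum N (cosCoeff N c₁ c) (fourierExp h) n) ∧
      ∃ n : ℤ, fourierExp h n ≠ 0 := by
  have := finiteDimensional_range_gainDerivOn h2 hV hmap
  obtain ⟨h, hh⟩ :=
    (hasEigenvalue_of_mem_spectrum_of_finiteDimensional_range _ hz hs).exists_hasEigenvector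
  have hT : (fun x => z * h.1 x) = trigPoly (Finset.Icc (-(N : ℤ)) N) fun n =>
          2 * cosCoeff N g₁ g n * modeSum N (cosCoeff N c₁ c) (fourierExp h.1) n := by
    rw [← gainDerivFun_cosPoly h2 (hV h.2)]
    exact (congrArg Subtype.val hh.apply_eq_smul).symm
  have hF : ∀ n, z * fourierExp h.1 n = if n ∈ Finset.Icc (-(N : ℤ)) N then
      2 * cosCoeff N g₁ g n * modeSum N (cosCoeff N c₁ c) (fourierExp h.1) n else 0 := by
    intro n
    rw [← fourierExp_trigPoly (Finset.Icc (-(N : ℤ)) N) (fun n =>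
      2 * cosCoeff N g₁ g n * modeSum N (cosCoeff N c₁ c) (fourierExp h.1) n), ← hT]
    unfold fourierExp
    rw [← mean_const_mul]
    congr 1; funext x; ring
  refine ⟨h.1, h.2, fun n hn => ?_, fun n hn => ?_, ?_⟩
  · have := hF n
    rw [if_neg (by rw [Finset.mem_Icc, ← abs_le]; omega)] at this
    exact (mul_eq_zero.1 this).resolve_left hz
  · rw [hF n, if_pos (by rwa [Finset.mem_Icc, ← abs_le])]
  · by_contra! h0
    refine hh.2 (Subtype.ext (funext fun x => ?_))
    have hx := congrFun hT x
    simp only [trigPoly, modeSum, h0, smul_zero, Finset.sum_const_zero, mul_zero, zero_mul] at hx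
    exact (mul_eq_zero.1 hx).resolve_left hz

theorem trigPoly_mem_evenPerturbations {H : ℤ → ℂ} (hH : ∀ k, H (-k) = H k) (h0 : H 0 = 0) :
    trigPoly (Finset.Icc (-(N : ℤ)) N) H ∈ evenPerturbations := by
  refine ⟨⟨continuous_trigPoly _ _, periodic_trigPoly _ _, ?_⟩, fun x => ?_⟩
  · rw [← fourierExp_zero, fourierExp_trigPoly, h0, ite_self]
  · unfold trigPoly
    refine Finset.sum_nbij' (fun k => -k) (fun k => -k) ?_ ?_ ?_ ?_ ?_
    · intro k hk; simp only [Finset.mem_Icc] at *; omega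
    · intro k hk; simp only [Finset.mem_Icc] at *; omega
    · simp
    · simp
    · intro k _
      rw [hH, expMode_neg]; push_cast; rfl

/-- Converse to `exists_fourierExp_of_mem_spectrum`: the trigonometric polynomial with coefficients
`H` is the eigenfunction. -/
theorem hasEigenvalue_evenGainDeriv (h2 : 2 ≤ N) {H : ℤ → ℂ} (hH : ∀ k, H (-k) = H k)
    (h0 : H 0 = 0) (hN : ∀ k : ℤ, (N : ℤ) < |k| → H k = 0) {m : ℤ} (hm : H m ≠ 0) {z : ℂ}
    (hz : ∀ n : ℤ, 1 ≤ n → n ≤ N →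
      z * H n = 2 * cosCoeff N g₁ g n * modeSum N (cosCoeff N c₁ c) H n) :
    (evenGainDeriv (cosPoly N g₁ g) (cosPoly N c₁ c)).HasEigenvalue z := by
  have hF : fourierExp (trigPoly (Finset.Icc (-(N : ℤ)) N) H) = H := by
    funext n
    rw [fourierExp_trigPoly]
    split_ifs with h
    · rfl
    · rw [Finset.mem_Icc, ← abs_le, not_le] at h
      exact (hN n h).symm
  have hmem : trigPoly (Finset.Icc (-(N : ℤ)) N) H ∈ evenPerturbations :=
    trigPoly_mem_evenPerturbations hH h0
  refine Module.End.hasEigenvalue_of_hasEigenvector (x := ⟨_, hmem⟩) ⟨?_, fun h => hm ?_⟩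
  · rw [Module.End.mem_eigenspace_iff]
    apply Subtype.ext
    change gainDerivFun _ _ _ = fun x => z * trigPoly (Finset.Icc (-(N : ℤ)) N) H x
    rw [gainDerivFun_cosPoly h2 hmem.1, hF]
    funext x
    unfold trigPoly
    rw [Finset.mul_sum]
    refine Finset.sum_congr rfl fun n hn => ?_
    rw [Finset.mem_Icc] at hn
    rw [← mul_assoc]
    congr 1
    rcases lt_trichotomy n 0 with h | h | h
    · have := hz (-n) (by omega) (by omega)
      rw [modeSum_neg cosCoeff_neg hH, cosCoeff_neg, hH] at this
      exact this.symm
    · subst h; beta_reduce; rw [modeSum_at_zero, h0]; simp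
    · exact (hz n (by omega) hn.2).symm
  · have := congrArg Subtype.val h
    rw [← hF, show trigPoly (Finset.Icc (-(N : ℤ)) N) H = fun _ => 0 from this]
    simp only [fourierExp, mul_zero]
    exact mean_const 0

theorem mem_spectrum_sub_one {V : Type*} [AddCommGroup V] [Module ℂ V] {T : Module.End ℂ V}
    {z : ℂ} (hz : z ∈ spectrum ℂ (T - 1)) : z + 1 ∈ spectrum ℂ T := by
  rw [spectrum.mem_iff] at hz ⊢
  rwa [map_add, map_one, ← sub_sub_eq_add_sub]

end spectrum

end CircleAlignment

namespace CircleAlignment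

/-! ### Estimates on mode sums -/

section estimates

variable {E : Type*} [NormedAddCommGroup E] [NormedSpace ℝ E] {N : ℕ}

theorem modeSum_sub_left (A B : ℤ → ℝ) (H : ℤ → E) (n : ℤ) :
    modeSum N (fun k => A k - B k) H n = modeSum N A H n - modeSum N B H n := by
  unfold modeSum
  rw [← Finset.sum_sub_distrib]
  exact Finset.sum_congr rfl fun k _ => by rw [mul_sub, sub_smul]

theorem modeSum_sub_right (A : ℤ → ℝ) (G H : ℤ → E) (n : ℤ) :
    modeSum N A (fun k => G k - H k) n = modeSum N A G n - modeSum N A H n := by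
  unfold modeSum
  rw [← Finset.sum_sub_distrib]
  exact Finset.sum_congr rfl fun k _ => by rw [smul_sub]

/-- All terms of a mode sum outside a finite set `s` contribute at most `2N+1` times their
maximal size. -/
theorem norm_modeSum_sub_sum_le (A : ℤ → ℝ) (H : ℤ → E) (n : ℤ) {s : Finset ℤ}
    (hs : s ⊆ Finset.Icc (-(N : ℤ)) N) {B : ℝ} (hB : 0 ≤ B)
    (h : ∀ k, k ∉ s → |A k| * ‖H (n - k)‖ ≤ B) :
    ‖modeSum N A H n - ∑ k ∈ s, (midWeight (n - 2 * k) * A k) • H (n - k)‖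
      ≤ (2 * N + 1) * B := by
  unfold modeSum
  rw [← Finset.sum_sdiff hs, add_sub_cancel_right]
  have hcard : ((Finset.Icc (-(N : ℤ)) N \ s).card : ℝ) ≤ 2 * N + 1 := by
    have h1 := Finset.card_le_card (Finset.sdiff_subset (s := Finset.Icc (-(N : ℤ)) N) (t := s))
    rw [Int.card_Icc] at h1
    have h2 : (Finset.Icc (-(N : ℤ)) N \ s).card ≤ 2 * N + 1 := by omega
    exact_mod_cast h2
  refine (norm_sum_le_of_le (f := fun k => (midWeight (n - 2 * k) * A k) • H (n - k))
    (n := fun _ => B) _ fun k hk => ?_).trans ?_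
  · rw [norm_smul, norm_mul, Real.norm_eq_abs, Real.norm_eq_abs]
    refine le_trans ?_ (h k (Finset.mem_sdiff.1 hk).2)
    rw [mul_assoc]
    exact mul_le_of_le_one_left (by positivity) (abs_midWeight_le_one _)
  · rw [Finset.sum_const, nsmul_eq_mul]
    exact mul_le_mul_of_nonneg_right hcard hB

theorem norm_modeSum_sub_le (A : ℤ → ℝ) (H : ℤ → E) (n : ℤ) {k₀ : ℤ} (hk₀ : |k₀| ≤ N) {B : ℝ}
    (hB : 0 ≤ B) (h : ∀ k, k ≠ k₀ → |A k| * ‖H (n - k)‖ ≤ B) :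
    ‖modeSum N A H n - (midWeight (n - 2 * k₀) * A k₀) • H (n - k₀)‖ ≤ (2 * N + 1) * B := by
  have := norm_modeSum_sub_sum_le (N := N) A H n (s := {k₀}) (by
    simpa [← abs_le] using hk₀) hB (fun k hk => h k (by simpa using hk))
  simpa using this

/-- The term `k = 0` is the diagonal part; every other term carries a coefficient of `A` of nonzero
order, which is small along the branch. -/
theorem norm_modeSum_le_of_left (A : ℤ → ℝ) (H : ℤ → E) (n : ℤ) (hA0 : A 0 = 1) {B : ℝ}
    (hB : 0 ≤ B) (h : ∀ k, k ≠ 0 → |A k| * ‖H (n - k)‖ ≤ B) :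
    ‖modeSum N A H n‖ ≤ |midWeight n| * ‖H n‖ + (2 * N + 1) * B := by
  have := norm_modeSum_sub_le (N := N) A H n (k₀ := 0) (by simp) hB h
  rw [mul_zero, sub_zero, hA0, mul_one] at this
  have h2 := norm_le_norm_add_norm_sub ((midWeight n) • H n) (modeSum N A H n)
  rw [norm_smul, Real.norm_eq_abs, norm_sub_rev] at h2
  linarith

/-- The quadratic mode sums of order at least two are Lipschitz. -/
theorem abs_modeSum_self_sub_le {A A' : ℤ → ℝ} {ρ d : ℝ} (hA : A 0 = 1) (hA' : A' 0 = 1)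
    (hρ : ∀ k, k ≠ 0 → |A k| ≤ ρ) (hρ' : ∀ k, k ≠ 0 → |A' k| ≤ ρ) (hd : ∀ k, |A k - A' k| ≤ d)
    {n : ℤ} (hn : 2 ≤ n) (hnN : n ≤ N) :
    |modeSum N A A n - modeSum N A' A' n| ≤ (1 / 2 + 2 * (2 * N + 1) * ρ) * d := by
  have hρ0 : 0 ≤ ρ := (abs_nonneg _).trans (hρ 1 one_ne_zero)
  have hd0 : 0 ≤ d := (abs_nonneg _).trans (hd 0)
  have e : modeSum N A A n - modeSum N A' A' n
      = modeSum N (fun k => A k - A' k) A n + modeSum N A' (fun k => A k - A' k) n := by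
    rw [modeSum_sub_left, modeSum_sub_right]; ring
  -- In the first half the mass coefficient is met at `k = n`, in the second at `k = 0`. Both
  -- leading terms have weight `midWeight n`, so together they cost at most `1/2`.
  have h1 := norm_modeSum_sub_le (N := N) (fun k => A k - A' k) A n (k₀ := n)
    (by rw [abs_of_nonneg] <;> omega) (mul_nonneg hd0 hρ0) (fun k hk =>
      mul_le_mul (hd k) (hρ _ (by omega)) (norm_nonneg _) hd0)
  have h2 := norm_modeSum_le_of_left (N := N) A' (fun k => A k - A' k) n hA'
    (mul_nonneg hρ0 hd0) (fun k hk =>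
      mul_le_mul (hρ' k hk) (hd _) (norm_nonneg _) hρ0)
  rw [sub_self, hA, show n - 2 * n = -n by ring, midWeight_neg] at h1
  simp only [smul_eq_mul, mul_one, Real.norm_eq_abs] at h1 h2
  have hw := two_mul_abs_midWeight_le (n := n) (by rwa [abs_of_nonneg (by omega)])
  have hdn := hd n
  rw [e]
  have h3 := abs_sub_abs_le_abs_sub (modeSum N (fun k => A k - A' k) A n)
    (midWeight n * (A n - A' n))
  rw [abs_mul] at h3
  have h4 := abs_add_le (modeSum N (fun k => A k - A' k) A n)
    (modeSum N A' (fun k => A k - A' k) n)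
  have h5 : |midWeight n| * |A n - A' n| ≤ |midWeight n| * d :=
    mul_le_mul_of_nonneg_left hdn (abs_nonneg _)
  nlinarith

end estimates

/-! ### The branch of solutions of the equations of order at least two -/

section branch

variable {N : ℕ}

/-- A vector `(x₀, …, x_N)`, extended by zero. -/
noncomputable def extendVec (x : Fin (N + 1) → ℝ) (k : ℕ) : ℝ :=
  if h : k < N + 1 then x ⟨k, h⟩ else 0

theorem abs_extendVec_sub_le (x y : Fin (N + 1) → ℝ) (k : ℕ) :
    |extendVec x k - extendVec y k| ≤ ‖x - y‖ := by
  unfold extendVec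
  split_ifs with h
  · exact norm_le_pi_norm (x - y) ⟨k, h⟩
  · simp

theorem abs_extendVec_le (x : Fin (N + 1) → ℝ) (k : ℕ) : |extendVec x k| ≤ ‖x‖ := by
  unfold extendVec
  split_ifs with h
  · exact norm_le_pi_norm x ⟨k, h⟩
  · simp

theorem abs_cosCoeff_sub_le {ε ε' : ℝ} {c c' : ℕ → ℝ} {d : ℝ} (h1 : |ε - ε'| ≤ d)
    (h : ∀ k, |c k - c' k| ≤ d) (k : ℤ) : |cosCoeff N ε c k - cosCoeff N ε' c' k| ≤ d := by
  have hd : 0 ≤ d := (abs_nonneg _).trans h1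
  unfold cosCoeff
  split_ifs <;> first | exact h1 | exact h _ | simpa using hd

theorem abs_cosCoeff_le {ε : ℝ} {c : ℕ → ℝ} {d : ℝ} (h1 : |ε| ≤ d)
    (h : ∀ k, |c k| ≤ d) {k : ℤ} (hk : k ≠ 0) : |cosCoeff N ε c k| ≤ d := by
  have hd : 0 ≤ d := (abs_nonneg _).trans h1
  unfold cosCoeff
  rw [if_neg (by omega)]
  split_ifs <;> first | exact h1 | exact h _ | simpa using hd

/-- The right-hand sides of the equations for the Fourier coefficients of order at least two, when
the first coefficient is `ε`. -/
noncomputable def branchMap (γ : ℕ → ℝ) (ε : ℝ) (x : Fin (N + 1) → ℝ) (j : Fin (N + 1)) : ℝ :=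
  -- The components `0` and `1` are placeholders: `cosCoeff` never reads them.
  if 2 ≤ (j : ℕ) then
    γ j * modeSum N (cosCoeff N ε (extendVec x)) (cosCoeff N ε (extendVec x)) (j : ℕ)
  else 0

/-- The radius in which the equations of order at least two are solved. -/
noncomputable def branchRadius (N : ℕ) : ℝ := 1 / (8 * (2 * N + 1))

theorem branchRadius_pos : 0 < branchRadius N := by unfold branchRadius; positivity

theorem mul_branchRadius : (2 * (N : ℝ) + 1) * branchRadius N = 1 / 8 := by
  unfold branchRadius; field_simp

variable {γ : ℕ → ℝ}

/-- The radius is chosen so that `1/2 + 2(2N+1)·radius = 3/4`. As the estimate is joint in `ε` and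
`x`, it yields the self-map property, the contraction and the dependence on `ε` at once. -/
theorem norm_branchMap_sub_le (hγ : ∀ k ∈ Finset.Icc 2 N, |γ k| ≤ 1) {ε ε' : ℝ}
    {x x' : Fin (N + 1) → ℝ} (hε : |ε| ≤ branchRadius N) (hε' : |ε'| ≤ branchRadius N)
    (hx : ‖x‖ ≤ branchRadius N) (hx' : ‖x'‖ ≤ branchRadius N) :
    ‖branchMap γ ε x - branchMap γ ε' x'‖ ≤ 3 / 4 * max |ε - ε'| ‖x - x'‖ := by
  have hm : 0 ≤ max |ε - ε'| ‖x - x'‖ := (abs_nonneg _).trans (le_max_left _ _)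
  rw [pi_norm_le_iff_of_nonneg (by positivity)]
  intro j
  rw [Pi.sub_apply, Real.norm_eq_abs]
  unfold branchMap
  split_ifs with hj
  · have hjN : (j : ℕ) ≤ N := by omega
    rw [← mul_sub, abs_mul]
    refine (mul_le_of_le_one_left (abs_nonneg _) (hγ _ (Finset.mem_Icc.2 ⟨hj, hjN⟩))).trans ?_
    refine (abs_modeSum_self_sub_le cosCoeff_zero cosCoeff_zero (ρ := branchRadius N)
      (d := max |ε - ε'| ‖x - x'‖)
      (fun k hk => abs_cosCoeff_le hε (fun i => (abs_extendVec_le x i).trans hx) hk)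
      (fun k hk => abs_cosCoeff_le hε' (fun i => (abs_extendVec_le x' i).trans hx') hk)
      (fun k => abs_cosCoeff_sub_le (le_max_left _ _)
        (fun i => (abs_extendVec_sub_le x x' i).trans (le_max_right _ _)) k)
      (by omega) (by omega)).trans (le_of_eq ?_)
    rw [mul_assoc 2, mul_branchRadius]; ring
  · simp

theorem branchMap_zero : branchMap γ 0 (0 : Fin (N + 1) → ℝ) = 0 := by
  funext j
  unfold branchMap
  split_ifs with hj
  · have e : ∀ k : ℤ, k ≠ 0 → cosCoeff N 0 (extendVec (0 : Fin (N + 1) → ℝ)) k = 0 := by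
      intro k hk
      simp [cosCoeff, extendVec, hk]
    unfold modeSum
    rw [Finset.sum_eq_zero, mul_zero, Pi.zero_apply]
    intro k _
    by_cases hk : k = 0
    · rw [e ((j : ℕ) - k) (by omega), smul_zero]
    · rw [e k hk, mul_zero, zero_smul]
  · rfl

theorem norm_branchMap_le (hγ : ∀ k ∈ Finset.Icc 2 N, |γ k| ≤ 1) {ε : ℝ}
    {x : Fin (N + 1) → ℝ} (hε : |ε| ≤ branchRadius N) (hx : ‖x‖ ≤ branchRadius N) :
    ‖branchMap γ ε x‖ ≤ 3 / 4 * max |ε| ‖x‖ := by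
  have := norm_branchMap_sub_le hγ hε (ε' := 0) (x' := 0)
    (by simpa using branchRadius_pos.le) hx (by simpa using branchRadius_pos.le)
  simpa [branchMap_zero] using this

theorem exists_branchMap_eq (hγ : ∀ k ∈ Finset.Icc 2 N, |γ k| ≤ 1) {ε : ℝ}
    (hε : |ε| ≤ branchRadius N) :
    ∃ x : Fin (N + 1) → ℝ, ‖x‖ ≤ branchRadius N ∧ branchMap γ ε x = x := by
  let B := Metric.closedBall (0 : Fin (N + 1) → ℝ) (branchRadius N)
  have hB : ∀ x : B, ‖x.1‖ ≤ branchRadius N := fun x => mem_closedBall_zero_iff.1 x.2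
  have : CompleteSpace B := Metric.isClosed_closedBall.completeSpace_coe
  have : Nonempty B := ⟨⟨0, Metric.mem_closedBall_self branchRadius_pos.le⟩⟩
  let F : B → B := fun x => ⟨branchMap γ ε x.1, mem_closedBall_zero_iff.2 <|
    (norm_branchMap_le hγ hε (hB x)).trans <| by
      have := max_le hε (hB x)
      have := branchRadius_pos (N := N)
      linarith⟩
  have hF : ContractingWith (3 / 4) F := by
    refine ⟨by rw [← NNReal.coe_lt_coe]; norm_num, LipschitzWith.of_dist_le_mul fun x y => ?_⟩
    rw [Subtype.dist_eq, Subtype.dist_eq, dist_eq_norm, dist_eq_norm]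
    refine (norm_branchMap_sub_le hγ hε hε (hB x) (hB y)).trans (le_of_eq ?_)
    rw [sub_self, abs_zero, max_eq_right (norm_nonneg _)]
    norm_num
  exact ⟨(hF.fixedPoint F).1, hB _, congrArg Subtype.val hF.fixedPoint_isFixedPt⟩

/-- Otherwise the maximum in the joint estimate would be `‖x - x'‖`, which would be at most `3/4` of
itself. This gives continuity of the branch in `ε` and, against `ε' = 0`, the bound of all
coefficients by `ε`. -/
theorem norm_sub_le_of_branchMap_eq (hγ : ∀ k ∈ Finset.Icc 2 N, |γ k| ≤ 1) {ε ε' : ℝ}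
    {x x' : Fin (N + 1) → ℝ} (hε : |ε| ≤ branchRadius N) (hε' : |ε'| ≤ branchRadius N)
    (hx : ‖x‖ ≤ branchRadius N) (hx' : ‖x'‖ ≤ branchRadius N) (h : branchMap γ ε x = x)
    (h' : branchMap γ ε' x' = x') : ‖x - x'‖ ≤ |ε - ε'| := by
  have := norm_branchMap_sub_le hγ hε hε' hx hx'
  rw [h, h'] at this
  by_contra! hlt
  rw [max_eq_right hlt.le] at this
  linarith [abs_nonneg (ε - ε')]

end branch

/-! ### Size of the coefficients along the branch -/

/-- Coefficients `A` of an even profile of mass one with small first coefficient `ε`, solving the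
stationarity equations of order at least two for the noise coefficients `γ`. -/
structure IsBranchCoeff (N : ℕ) (γ : ℕ → ℝ) (ε : ℝ) (A : ℤ → ℝ) : Prop where
  two_le : 2 ≤ N
  noise_le : ∀ k ∈ Finset.Icc 2 N, |γ k| ≤ 1
  pos : 0 < ε
  le_radius : ε ≤ branchRadius N
  zero : A 0 = 1
  one : A 1 = ε
  even : ∀ k, A (-k) = A k
  abs_le : ∀ k, k ≠ 0 → |A k| ≤ ε
  eq_zero : ∀ k : ℤ, (N : ℤ) < |k| → A k = 0
  equation : ∀ n : ℕ, 2 ≤ n → n ≤ N → A n = γ n * modeSum N A A n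

theorem isBranchCoeff_of_branchMap_eq {N : ℕ} {γ : ℕ → ℝ} (h2 : 2 ≤ N)
    (hγ : ∀ k ∈ Finset.Icc 2 N, |γ k| ≤ 1) {ε : ℝ} (hε0 : 0 < ε) (hε : ε ≤ branchRadius N)
    {x : Fin (N + 1) → ℝ} (hx : ‖x‖ ≤ branchRadius N) (h : branchMap γ ε x = x) :
    IsBranchCoeff N γ ε (cosCoeff N ε (extendVec x)) where
  two_le := h2
  noise_le := hγ
  pos := hε0
  le_radius := hε
  zero := cosCoeff_zero
  one := cosCoeff_one
  even := cosCoeff_neg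
  abs_le k hk := by
    have hxε : ‖x‖ ≤ ε := by
      have := norm_sub_le_of_branchMap_eq hγ (ε' := 0) (x' := 0) (by rwa [abs_of_pos hε0])
        (by simpa using branchRadius_pos.le) hx (by simpa using branchRadius_pos.le) h
        branchMap_zero
      simpa [abs_of_pos hε0] using this
    exact abs_cosCoeff_le (abs_of_pos hε0).le (fun i => (abs_extendVec_le x i).trans hxε) hk
  eq_zero k hk := cosCoeff_of_lt h2 hk
  equation n hn hnN := by
    have := congrFun h ⟨n, by omega⟩
    unfold branchMap at this
    rw [if_pos hn] at this
    rw [cosCoeff_of_two_le (by omega) (by omega), Int.natAbs_natCast, extendVec,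
      dif_pos (by omega : n < N + 1)]
    exact this.symm

namespace IsBranchCoeff

variable {N : ℕ} {γ : ℕ → ℝ} {ε : ℝ} {A : ℤ → ℝ}

theorem mul_le (h : IsBranchCoeff N γ ε A) : (2 * (N : ℝ) + 1) * ε ≤ 1 / 8 := by
  rw [← mul_branchRadius]
  exact mul_le_mul_of_nonneg_left h.le_radius (by positivity)

/-- A bound on the quadratic terms not involving `A 0` bounds a coefficient. -/
theorem abs_le_of_forall (h : IsBranchCoeff N γ ε A) {n : ℕ} (hn : 2 ≤ n) {B : ℝ}
    (hB : ∀ k : ℤ, k ≠ 0 → k ≠ n → |A k| * |A (n - k)| ≤ B) (hB0 : 0 ≤ B) :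
    |A n| ≤ 2 * ((2 * N + 1) * B) := by
  by_cases hnN : n ≤ N
  · have hne : (0 : ℤ) ≠ n := by omega
    -- The terms `k = 0` and `k = n` both equal `midWeight n * A n`. Their sum is at most half of
    -- `|A n|` and is absorbed on the left, whence the factor `2`.
    have h1 := norm_modeSum_sub_sum_le (N := N) A A n (s := {0, (n : ℤ)}) (by
      intro k hk
      simp only [Finset.mem_insert, Finset.mem_singleton] at hk
      rw [Finset.mem_Icc]; omega) hB0 (fun k hk => by
        simp only [Finset.mem_insert, Finset.mem_singleton, not_or] at hk
        exact hB k hk.1 hk.2)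
    rw [Finset.sum_pair hne] at h1
    have e : (n : ℤ) - 2 * n = -n := by ring
    simp only [mul_zero, sub_zero, sub_self, h.zero, mul_one, smul_eq_mul, Real.norm_eq_abs, e,
      midWeight_neg] at h1
    have hw := two_mul_abs_midWeight_le (n := (n : ℤ)) (by rw [abs_of_nonneg] <;> omega)
    have heq := h.equation n hn hnN
    have hγ := h.noise_le n (Finset.mem_Icc.2 ⟨hn, hnN⟩)
    have hle : |A n| ≤ |modeSum N A A n| := by
      conv_lhs => rw [heq]
      rw [abs_mul]
      exact mul_le_of_le_one_left (abs_nonneg _) hγ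
    have h3 := abs_sub_abs_le_abs_sub (modeSum N A A n)
      (midWeight n * A n + midWeight n * A n)
    rw [← two_mul, abs_mul, abs_mul, abs_two, ← mul_assoc, two_mul (midWeight n * A n)] at h3
    nlinarith [abs_nonneg (A n)]
  · rw [h.eq_zero n (by rw [abs_of_nonneg] <;> omega), abs_zero]
    positivity

theorem abs_natAbs (h : IsBranchCoeff N γ ε A) (k : ℤ) : A k = A (k.natAbs : ℤ) := by
  rcases Int.natAbs_eq k with hk | hk
  · exact congrArg A hk
  · rw [hk, h.even]; simp

theorem abs_le_sq (h : IsBranchCoeff N γ ε A) {k : ℤ} (hk : 2 ≤ |k|) :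
    |A k| ≤ 2 * (2 * N + 1) * ε ^ 2 := by
  have hε := h.pos
  rw [h.abs_natAbs]
  refine (h.abs_le_of_forall (n := k.natAbs) (by grind) (B := ε * ε) (fun i hi hin => ?_)
    (by positivity)).trans (le_of_eq (by ring))
  exact mul_le_mul (h.abs_le i hi) (h.abs_le _ (by omega)) (abs_nonneg _) hε.le

/-- When an odd order is a sum of two nonzero orders, one of them is even, hence at least two in
modulus and of size `ε²`; the other contributes `ε`. -/
theorem abs_le_cube (h : IsBranchCoeff N γ ε A) {k : ℤ} (hk : 2 ≤ |k|) (ho : Odd k) :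
    |A k| ≤ 4 * (2 * N + 1) ^ 2 * ε ^ 3 := by
  have hε := h.pos
  have ho' : Odd k.natAbs := Int.natAbs_odd.2 ho
  rw [h.abs_natAbs]
  refine (h.abs_le_of_forall (n := k.natAbs) (by grind)
    (B := 2 * (2 * N + 1) * ε ^ 2 * ε) (fun i hi hin => ?_)
    (by positivity)).trans (le_of_eq (by ring))
  obtain ⟨m, hm⟩ := ho'
  rcases Int.even_or_odd' i with ⟨j, rfl | rfl⟩
  · exact mul_le_mul (h.abs_le_sq (by grind)) (h.abs_le _ (by omega)) (abs_nonneg _)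
      (by positivity)
  · rw [mul_comm]
    exact mul_le_mul (h.abs_le_sq (by grind)) (h.abs_le _ (by omega)) (abs_nonneg _)
      (by positivity)

theorem coeff_two (h : IsBranchCoeff N γ ε A) : A 2 = γ 2 * ε ^ 2 := by
  have h1 := h.equation 2 le_rfl h.two_le
  have h2 := h.two_le
  have h3 := modeSum_two_mul N A A (m := 1) (by simp; omega)
  rw [h.one, smul_eq_mul] at h3
  norm_num at h1 h3
  rw [h1, h3]; ring

/-- Expansion of the first stationarity equation along the branch. -/
theorem abs_modeSum_one_sub_le (h : IsBranchCoeff N γ ε A) :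
    |modeSum N A A 1 - (4 / π * ε - 4 / (3 * π) * γ 2 * ε ^ 3)|
      ≤ 8 * (2 * N + 1) ^ 4 * ε ^ 5 := by
  have hε := h.pos
  have h2 := h.two_le
  -- The terms `k = 0, 1` give the linear part and `k = 2, -1` the cubic one. In all others `k` and
  -- `1 - k` have modulus at least two and opposite parity, so the product is `O(ε² · ε³)`.
  have hmem : ({0, 1, 2, -1} : Finset ℤ) ⊆ Finset.Icc (-(N : ℤ)) N := by
    intro k hk
    simp only [Finset.mem_insert, Finset.mem_singleton] at hk
    rw [Finset.mem_Icc]; omega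
  have h1 := norm_modeSum_sub_sum_le (N := N) A A 1 hmem
    (B := 2 * (2 * N + 1) * ε ^ 2 * (4 * (2 * N + 1) ^ 2 * ε ^ 3)) (by positivity)
    (fun k hk => by
      simp only [Finset.mem_insert, Finset.mem_singleton, not_or] at hk
      rcases Int.even_or_odd' k with ⟨j, rfl | rfl⟩
      · exact mul_le_mul (h.abs_le_sq (by grind)) (h.abs_le_cube (by grind) ⟨-j, by ring⟩)
          (abs_nonneg _) (by positivity)
      · rw [mul_comm]
        exact mul_le_mul (h.abs_le_sq (by grind)) (h.abs_le_cube (by grind) ⟨j, rfl⟩)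
          (abs_nonneg _) (by positivity))
  rw [Finset.sum_insert (by decide), Finset.sum_insert (by decide), Finset.sum_insert (by decide),
    Finset.sum_singleton] at h1
  have hm1 : A (-1) = ε := by rw [h.even, h.one]
  have w1 : midWeight (-1) = 2 / π := by rw [midWeight_neg, midWeight_one]
  have w3 : midWeight (-3) = -(2 / (3 * π)) := by rw [midWeight_neg, midWeight_three]
  norm_num [h.zero, h.one, hm1, w1, w3, midWeight_one, midWeight_three, h.coeff_two,
    -midWeight_zero] at h1
  refine le_trans (le_of_eq ?_) (h1.trans (le_of_eq (by ring)))
  congr 1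
  field_simp
  ring

end IsBranchCoeff

end CircleAlignment

/-! ### The amplitude equation and its solution by the intermediate value theorem. -/

namespace CircleAlignment

/-- The pitchfork equation. The factor `ε`, which stands for the uniform solution, is kept visible
so that it can be divided out. -/
theorem IsBranchCoeff.abs_mul_modeSum_sub_le {N : ℕ} {γ : ℕ → ℝ} {ε : ℝ} {A : ℤ → ℝ}
    (h : IsBranchCoeff N γ ε A) {s : ℝ} (hs0 : 0 ≤ s) (hs1 : s ≤ 1) :
    |s * modeSum N A A 1 - ε
        - ε * (4 / π * (s - π / 4) - 4 * s / (3 * π) * γ 2 * ε ^ 2)|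
      ≤ ε * (8 * (2 * N + 1) ^ 4 * ε ^ 4) := by
  have h1 := h.abs_modeSum_one_sub_le
  have e : s * modeSum N A A 1 - ε
        - ε * (4 / π * (s - π / 4) - 4 * s / (3 * π) * γ 2 * ε ^ 2)
      = s * (modeSum N A A 1 - (4 / π * ε - 4 / (3 * π) * γ 2 * ε ^ 3)) := by
    field_simp; ring
  rw [e, abs_mul, abs_of_nonneg hs0]
  refine (mul_le_of_le_one_left (abs_nonneg _) hs1).trans (h1.trans (le_of_eq (by ring)))

/-- The smallness condition on the distance `δ` of the parameter to its critical value. -/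
theorem sqrt_le_branchRadius {N : ℕ} {q δ : ℝ} (hq : 0 < q) (hq1 : q ≤ 1)
    (hδ : 2000 * (2 * N + 1) ^ 4 * δ ≤ q ^ 2) : √(12 * δ / q) ≤ branchRadius N := by
  have hK : (1 : ℝ) ≤ 2 * N + 1 := by linarith [(Nat.cast_nonneg N : (0 : ℝ) ≤ N)]
  set K : ℝ := 2 * N + 1
  rw [show branchRadius N = 1 / (8 * K) from rfl]
  refine Real.sqrt_le_iff.2 ⟨by positivity, ?_⟩
  rw [div_pow, one_pow, div_le_div_iff₀ hq (by positivity)]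
  by_cases hδ0 : δ ≤ 0
  · nlinarith [mul_nonneg (neg_nonneg.2 hδ0) (sq_nonneg (8 * K))]
  · push Not at hδ0
    have h1 : K ^ 2 ≤ K ^ 4 := pow_le_pow_right₀ hK (by norm_num)
    have h2 : K ^ 2 * δ ≤ K ^ 4 * δ := mul_le_mul_of_nonneg_right h1 hδ0.le
    nlinarith

/-- At `ε² = δ` the cubic term takes at most a third of the linear one, and what is left dominates
the remainder. -/
theorem lower_endpoint_estimate {s b X δ : ℝ} (hδ : 0 < δ) (hs1 : s ≤ 1)
    (hb0 : 0 ≤ b) (hb1 : b ≤ 1) (hX : 2000 * X * δ ≤ 1) :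
    8 * X * δ ^ 2 ≤ 4 / π * δ - 4 * s / (3 * π) * b * δ := by
  have h1 : 1 ≤ 4 / π := by rw [le_div_iff₀ pi_pos]; linarith [pi_le_four]
  have h2 : 4 * s / (3 * π) * b ≤ 4 / π / 3 := by
    rw [div_mul_eq_mul_div, div_div, mul_comm π 3, div_le_div_iff_of_pos_right (by positivity)]
    linarith [mul_le_one₀ hs1 hb0 hb1]
  have h3 : 0 ≤ 4 / π - 4 * s / (3 * π) * b - 8 * X * δ := by linarith
  linarith [mul_nonneg h3 hδ.le]

/-- At `ε² = 12δ/q` the cubic term is at least `(1/3)(q/2)(12δ/q) = 2δ`, while the linear term is at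
most `1.28δ` and the remainder at most `0.6δ`; the constant `2000` serves the last bound. -/
theorem upper_endpoint_estimate {s b q X δ : ℝ} (hδ : 0 < δ) (hs : π / 4 ≤ s) (hq : 0 < q)
    (hb : q / 2 ≤ b) (hX : 2000 * X * δ ≤ q ^ 2) :
    8 * X * (12 * δ / q) ^ 2 ≤ -(4 / π * δ - 4 * s / (3 * π) * b * (12 * δ / q)) := by
  have h1 : 4 / π * δ ≤ 1.28 * δ := by
    refine mul_le_mul_of_nonneg_right ?_ hδ.le
    rw [div_le_iff₀ pi_pos]; linarith [pi_gt_d2]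
  have h2 : 1 / 3 ≤ 4 * s / (3 * π) := by
    rw [div_le_div_iff₀ (by norm_num) (by positivity)]; linarith
  have h3 : 2 * δ ≤ 4 * s / (3 * π) * b * (12 * δ / q) := by
    have h4 : 1 / 3 * (q / 2) ≤ 4 * s / (3 * π) * b :=
      mul_le_mul h2 hb (by positivity) (le_trans (by norm_num) h2)
    calc 2 * δ = 1 / 3 * (q / 2) * (12 * δ / q) := by field_simp; norm_num
      _ ≤ _ := mul_le_mul_of_nonneg_right h4 (by positivity)
  have h5 : 8 * X * (12 * δ / q) ^ 2 ≤ 0.6 * δ := by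
    rw [div_pow, ← mul_div_assoc, div_le_iff₀ (by positivity)]
    linarith [mul_le_mul_of_nonneg_left hX hδ.le, mul_nonneg hδ.le (sq_nonneg q)]
  linarith

theorem exists_branchCoeff_stationary {N : ℕ} (h2 : 2 ≤ N) {γ : ℕ → ℝ}
    (hγ : ∀ k ∈ Finset.Icc 2 N, |γ k| ≤ 1) {q : ℝ} (hq : 0 < q) (hqγ : q / 2 ≤ γ 2)
    (hq1 : q ≤ 1) {s : ℝ} (hs0 : π / 4 < s) (hs1 : s ≤ 1)
    (hδ : 2000 * (2 * N + 1) ^ 4 * (s - π / 4) ≤ q ^ 2) :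
    ∃ ε ∈ Set.Icc (√(s - π / 4)) (√(12 * (s - π / 4) / q)), ∃ c : ℕ → ℝ,
      IsBranchCoeff N γ ε (cosCoeff N ε c) ∧
      ε = s * modeSum N (cosCoeff N ε c) (cosCoeff N ε c) 1 := by
  have hs : 0 < s := by linarith [pi_pos]
  set δ := s - π / 4 with hδdef
  have hδ0 : 0 < δ := by linarith
  have hK : (1 : ℝ) ≤ 2 * N + 1 := by linarith [(Nat.cast_nonneg N : (0 : ℝ) ≤ N)]
  have hrad := sqrt_le_branchRadius hq hq1 hδ
  set ε₁ := √δ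
  set ε₂ := √(12 * δ / q)
  have hε₁ : 0 < ε₁ := Real.sqrt_pos.2 hδ0
  have hε₁sq : ε₁ ^ 2 = δ := Real.sq_sqrt hδ0.le
  have hε₂sq : ε₂ ^ 2 = 12 * δ / q := Real.sq_sqrt (by positivity)
  have hε₁₂ : ε₁ ≤ ε₂ := Real.sqrt_le_sqrt (by rw [le_div_iff₀ hq]; nlinarith)
  -- Stated for all real `ε`, with a dummy value off the interval, so that `choose` gives a plain
  -- function of `ε`.
  have hex : ∀ ε : ℝ, ∃ x : Fin (N + 1) → ℝ, ε ∈ Set.Icc ε₁ ε₂ →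
      ‖x‖ ≤ branchRadius N ∧ branchMap γ ε x = x := by
    intro ε
    by_cases hε : ε ∈ Set.Icc ε₁ ε₂
    · obtain ⟨x, hx⟩ := exists_branchMap_eq hγ (ε := ε)
        (by rw [abs_of_pos (hε₁.trans_le hε.1)]; exact hε.2.trans hrad)
      exact ⟨x, fun _ => hx⟩
    · exact ⟨0, fun h => absurd h hε⟩
  choose x hx using hex
  have hbranch : ∀ ε ∈ Set.Icc ε₁ ε₂, IsBranchCoeff N γ ε (cosCoeff N ε (extendVec (x ε))) :=
    fun ε hε => isBranchCoeff_of_branchMap_eq h2 hγ (hε₁.trans_le hε.1) (hε.2.trans hrad)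
      (hx ε hε).1 (hx ε hε).2
  have hcoef : ∀ k : ℤ, ContinuousOn (fun ε => cosCoeff N ε (extendVec (x ε)) k)
      (Set.Icc ε₁ ε₂) := by
    intro k
    refine LipschitzOnWith.continuousOn (K := 1) (LipschitzOnWith.of_dist_le_mul ?_)
    intro ε hε ε' hε'
    rw [Real.dist_eq, Real.dist_eq, NNReal.coe_one, one_mul]
    have habs : ∀ η ∈ Set.Icc ε₁ ε₂, |η| ≤ branchRadius N := fun η hη => by
      rw [abs_of_pos (hε₁.trans_le hη.1)]; exact hη.2.trans hrad
    exact abs_cosCoeff_sub_le le_rfl (fun i => (abs_extendVec_sub_le _ _ i).trans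
      (norm_sub_le_of_branchMap_eq hγ (habs ε hε) (habs ε' hε') (hx ε hε).1 (hx ε' hε').1
        (hx ε hε).2 (hx ε' hε').2)) k
  set φ : ℝ → ℝ := fun ε => s * modeSum N (cosCoeff N ε (extendVec (x ε)))
    (cosCoeff N ε (extendVec (x ε))) 1 - ε with hφ
  have hcont : ContinuousOn φ (Set.Icc ε₁ ε₂) := by
    refine ContinuousOn.sub (ContinuousOn.mul continuousOn_const ?_) continuousOn_id
    unfold modeSum
    simp only [smul_eq_mul]
    exact continuousOn_finsetSum _ fun k _ =>
      (continuousOn_const.mul (hcoef k)).mul (hcoef _)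
  have hest : ∀ ε ∈ Set.Icc ε₁ ε₂, |φ ε
        - ε * (4 / π * δ - 4 * s / (3 * π) * γ 2 * ε ^ 2)|
      ≤ ε * (8 * (2 * N + 1) ^ 4 * ε ^ 4) := fun ε hε =>
    (hbranch ε hε).abs_mul_modeSum_sub_le hs.le hs1
  have hγ2 : γ 2 ≤ 1 := (le_abs_self _).trans (hγ 2 (Finset.mem_Icc.2 ⟨le_rfl, h2⟩))
  have hγ2' : 0 < γ 2 := by linarith
  set K : ℝ := 2 * N + 1
  have hq2 : 2000 * K ^ 4 * δ ≤ 1 := hδ.trans (pow_le_one₀ hq.le hq1)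
  have h1 : 0 ≤ φ ε₁ := by
    have := (abs_le.1 (hest ε₁ ⟨le_rfl, hε₁₂⟩)).1
    rw [show ε₁ ^ 4 = (ε₁ ^ 2) ^ 2 by ring, hε₁sq] at this
    have h3 := lower_endpoint_estimate hδ0 hs1 hγ2'.le hγ2 hq2
    linarith [mul_le_mul_of_nonneg_left h3 hε₁.le]
  have h2' : φ ε₂ ≤ 0 := by
    have := (abs_le.1 (hest ε₂ ⟨hε₁₂, le_rfl⟩)).2
    rw [show ε₂ ^ 4 = (ε₂ ^ 2) ^ 2 by ring, hε₂sq] at this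
    have h3 := upper_endpoint_estimate hδ0 hs0.le hq hqγ hδ
    linarith [mul_le_mul_of_nonneg_left h3 (hε₁.le.trans hε₁₂)]
  obtain ⟨ε, hε, h0⟩ := intermediate_value_Icc' hε₁₂ hcont ⟨h2', h1⟩
  exact ⟨ε, hε, extendVec (x ε), hbranch ε hε, by simp only [hφ] at h0; linarith⟩

end CircleAlignment

namespace CircleAlignment

/-! ### Real eigenvalues of perturbed diagonal matrices -/

section matrix

variable {ι : Type*} [Fintype ι] [DecidableEq ι] {M : Matrix ι ι ℝ} {D : ι → ℝ} {η : ℝ}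

/-- On the segment from the diagonal matrix to `M` no determinant vanishes: a kernel vector, read at
its largest coordinate `i`, would force `|D i| ≤ η`. So the determinant keeps its sign. -/
theorem det_mul_det_pos_of_near_diagonal (hM : ∀ v i, |(M.mulVec v) i - D i * v i| ≤ η * ‖v‖)
    (hD : ∀ i, η < |D i|) : 0 < (∏ i, D i) * M.det := by
  let F : ℝ → Matrix ι ι ℝ := fun t => Matrix.diagonal D + t • (M - Matrix.diagonal D)
  have hF0 : (F 0).det = ∏ i, D i := by simp [F]
  have hF1 : F 1 = M := by simp [F]
  have hcont : Continuous fun t => (F t).det := by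
    refine Continuous.matrix_det ?_
    exact continuous_const.add (continuous_id.smul continuous_const)
  have hne : ∀ t ∈ Set.Icc (0 : ℝ) 1, (F t).det ≠ 0 := by
    intro t ht h0
    obtain ⟨v, hv0, hv⟩ := Matrix.exists_mulVec_eq_zero_iff.2 h0
    have hvpos : 0 < ‖v‖ := norm_pos_iff.2 hv0
    have hle : ∀ i, |D i| * |v i| ≤ η * ‖v‖ := by
      intro i
      have hi := congrFun hv i
      simp only [F, Matrix.add_mulVec, Matrix.smul_mulVec, Matrix.sub_mulVec, Pi.add_apply,
        Pi.smul_apply, Pi.sub_apply, Matrix.mulVec_diagonal, smul_eq_mul, Pi.zero_apply] at hi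
      have e : D i * v i = -(t * ((M.mulVec v) i - D i * v i)) := by linarith
      rw [← abs_mul, e, abs_neg, abs_mul, abs_of_nonneg ht.1]
      exact (mul_le_of_le_one_left (abs_nonneg _) ht.2).trans (hM v i)
    have : Nonempty ι := by
      by_contra hemp
      rw [not_nonempty_iff] at hemp
      exact hv0 (Subsingleton.elim _ _)
    obtain ⟨i, hi⟩ := Finite.exists_max fun i => ‖v i‖
    have hvi : ‖v‖ ≤ |v i| := (pi_norm_le_iff_of_nonneg (norm_nonneg _)).2 hi
    have h1 := mul_le_mul_of_nonneg_left hvi (abs_nonneg (D i))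
    have h2 := mul_lt_mul_of_pos_right (hD i) hvpos
    linarith [hle i]
  rw [← hF0, ← hF1]
  by_contra! hle
  have h01 : (0 : ℝ) ∈ Set.uIcc (F 0).det (F 1).det := by
    rw [Set.mem_uIcc]
    rcases mul_nonpos_iff.1 hle with h | h
    · exact Or.inr ⟨h.2, h.1⟩
    · exact Or.inl h
  obtain ⟨t, ht, h0⟩ := intermediate_value_uIcc (a := 0) (b := 1) hcont.continuousOn h01
  rw [Set.uIcc_of_le zero_le_one] at ht
  exact hne t ht h0

/-- A matrix close to a diagonal matrix, one entry of which is separated from all others, has a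
real eigenvalue close to that entry. -/
theorem exists_eigenvalue_of_near_diagonal
    (hM : ∀ v i, |(M.mulVec v) i - D i * v i| ≤ η * ‖v‖) (hη : 0 ≤ η) {a b : ℝ} (hab : a ≤ b)
    (i₀ : ι) (h₀ : η < D i₀ - a) (h : ∀ i, i ≠ i₀ → η < a - D i) (hb : ∀ i, η < b - D i) :
    ∃ r ∈ Set.Icc a b, ∃ v : ι → ℝ, v ≠ 0 ∧ M.mulVec v = r • v := by
  let F : ℝ → Matrix ι ι ℝ := fun r => r • 1 - M
  have hF : ∀ r v i, |((F r).mulVec v) i - (r - D i) * v i| ≤ η * ‖v‖ := by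
    intro r v i
    rw [← abs_neg]
    refine le_trans (le_of_eq ?_) (hM v i)
    congr 1
    simp only [F, Matrix.sub_mulVec, Matrix.smul_mulVec, Matrix.one_mulVec, Pi.sub_apply,
      Pi.smul_apply, smul_eq_mul]
    ring
  -- At `a` exactly one diagonal entry of `a - D` is negative, at `b` none is; hence the determinant
  -- changes sign.
  have ha' : (F a).det < 0 := by
    have := det_mul_det_pos_of_near_diagonal (hF a) (fun i => by
      by_cases hi : i = i₀
      · subst hi; rw [abs_of_neg] <;> linarith
      · have := h i hi
        rw [abs_of_pos] <;> linarith)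
    refine neg_of_mul_pos_right this (le_of_lt ?_)
    rw [← Finset.mul_prod_erase _ _ (Finset.mem_univ i₀)]
    refine mul_neg_of_neg_of_pos (by linarith) (Finset.prod_pos fun i hi => ?_)
    linarith [h i (Finset.ne_of_mem_erase hi)]
  have hb' : 0 < (F b).det := by
    have := det_mul_det_pos_of_near_diagonal (hF b) (fun i => by
      have := hb i
      rw [abs_of_pos] <;> linarith)
    exact pos_of_mul_pos_right this (Finset.prod_pos fun i _ => by linarith [hb i]).le
  have hcont : Continuous fun r => (F r).det :=
    Continuous.matrix_det ((continuous_id.smul continuous_const).sub continuous_const)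
  obtain ⟨r, hr, h0⟩ := intermediate_value_Icc hab hcont.continuousOn ⟨ha'.le, hb'.le⟩
  obtain ⟨v, hv0, hv⟩ := Matrix.exists_mulVec_eq_zero_iff.2 h0
  refine ⟨r, hr, v, hv0, ?_⟩
  simp only [F, Matrix.sub_mulVec, Matrix.smul_mulVec, Matrix.one_mulVec] at hv
  exact (sub_eq_zero.1 hv).symm

end matrix

/-! ### Fourier coefficients of eigenfunctions -/

/-- Fourier coefficients `H` of an even eigenfunction, with eigenvalue `z`, of the linearized gain
term with noise coefficients `g` at the profile with coefficients `A`. -/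
structure IsEigenCoeff (N : ℕ) (g A : ℤ → ℝ) (z : ℂ) (H : ℤ → ℂ) : Prop where
  even : ∀ k, H (-k) = H k
  zero : H 0 = 0
  eq_zero : ∀ k : ℤ, (N : ℤ) < |k| → H k = 0
  equation : ∀ n : ℤ, 1 ≤ n → n ≤ N → z * H n = 2 * g n * modeSum N A H n

/-- The even extension to all integers of a vector indexed by `1, …, N`. -/
noncomputable def evenExtend {N : ℕ} (v : Fin N → ℝ) (k : ℤ) : ℝ :=
  if h : 1 ≤ k.natAbs ∧ k.natAbs ≤ N then v ⟨k.natAbs - 1, by omega⟩ else 0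

theorem abs_evenExtend_le {N : ℕ} (v : Fin N → ℝ) (k : ℤ) : |evenExtend v k| ≤ ‖v‖ := by
  unfold evenExtend
  split_ifs with h
  · exact norm_le_pi_norm v _
  · simp

theorem evenExtend_succ {N : ℕ} (v : Fin N → ℝ) (i : Fin N) :
    evenExtend v ((i : ℕ) + 1 : ℕ) = v i := by
  unfold evenExtend
  rw [dif_pos (by omega)]
  congr 1

/-- The linearized gain term on the coefficients `1, …, N` of even functions. -/
noncomputable def eigenMap (N : ℕ) (g A : ℤ → ℝ) : (Fin N → ℝ) →ₗ[ℝ] (Fin N → ℝ) where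
  toFun v i := 2 * g ((i : ℕ) + 1 : ℕ) * modeSum N A (evenExtend v) ((i : ℕ) + 1 : ℕ)
  map_add' v w := by
    have e : ∀ k, evenExtend (v + w) k = evenExtend v k + evenExtend w k := by
      intro k; unfold evenExtend; split_ifs <;> simp
    funext i
    simp only [modeSum, e, smul_add, Finset.sum_add_distrib, Pi.add_apply]
    ring
  map_smul' c v := by
    have e : ∀ k, evenExtend (c • v) k = c * evenExtend v k := by
      intro k; unfold evenExtend; split_ifs <;> simp
    funext i
    simp only [modeSum, e, smul_eq_mul, Pi.smul_apply, RingHom.id_apply, Finset.mul_sum]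
    exact Finset.sum_congr rfl fun k _ => by ring

namespace IsBranchCoeff

variable {N : ℕ} {γ : ℕ → ℝ} {ε : ℝ} {A : ℤ → ℝ} {g : ℤ → ℝ}

/-- The linearized gain term has a real eigenvalue close to `1`. -/
theorem exists_real_isEigenCoeff (h : IsBranchCoeff N γ ε A) (hg : ∀ n : ℤ, |g n| ≤ 1)
    (hε : 32 * (2 * N + 1) * ε ≤ 1) (hg1 : π / 4 ≤ g 1) (hg1' : 4 / π * g 1 ≤ 9 / 8) :
    ∃ r ∈ Set.Icc (3 / 4 : ℝ) (5 / 4), ∃ H, IsEigenCoeff N g A r H ∧ ∃ n, H n ≠ 0 := by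
  have hε0 := h.pos
  have h2 := h.two_le
  have hpi := pi_pos
  -- The entry at `i₀` lies in `[1, 9/8]`, the others in `[-1/2, 1/2]`, and the perturbation is at
  -- most `1/16`. The points `3/4` and `5/4` keep distance at least `1/8` from all entries.
  let D : Fin N → ℝ := fun i => 2 * g ((i : ℕ) + 1 : ℕ) * midWeight ((i : ℕ) + 1 : ℕ)
  let i₀ : Fin N := ⟨0, by omega⟩
  have hD0 : D i₀ = 4 / π * g 1 := by
    simp only [D, i₀]
    norm_num [midWeight_one]; ring
  have hD : ∀ i, i ≠ i₀ → |D i| ≤ 1 / 2 := by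
    intro i hi
    have hi' : 1 ≤ (i : ℕ) := by
      by_contra hlt
      exact hi (Fin.ext (by simp only [i₀]; omega))
    have hw := two_mul_abs_midWeight_le (n := ((i : ℕ) + 1 : ℕ)) (by rw [abs_of_nonneg] <;> omega)
    simp only [D]
    rw [abs_mul, abs_mul, abs_two]
    refine le_trans ?_ hw
    refine mul_le_mul_of_nonneg_right ?_ (abs_nonneg _)
    linarith [hg ((i : ℕ) + 1 : ℕ)]
  have hM : ∀ v i, |((LinearMap.toMatrix' (eigenMap N g A)).mulVec v) i - D i * v i|
      ≤ (2 * ((2 * N + 1) * ε)) * ‖v‖ := by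
    intro v i
    rw [LinearMap.toMatrix'_mulVec]
    have h1 := norm_modeSum_sub_le (N := N) A (evenExtend v) ((i : ℕ) + 1 : ℕ) (k₀ := 0)
      (by simp) (B := ε * ‖v‖) (by positivity) (fun k hk =>
        mul_le_mul (h.abs_le k hk) (abs_evenExtend_le v _) (norm_nonneg _) hε0.le)
    rw [mul_zero, sub_zero, h.zero, mul_one, evenExtend_succ, smul_eq_mul, Real.norm_eq_abs] at h1
    have e : eigenMap N g A v i - D i * v i = 2 * g ((i : ℕ) + 1 : ℕ) *
        (modeSum N A (evenExtend v) ((i : ℕ) + 1 : ℕ) - midWeight ((i : ℕ) + 1 : ℕ) * v i) := by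
      simp only [eigenMap, D, LinearMap.coe_mk, AddHom.coe_mk]; ring
    rw [e, abs_mul, abs_mul, abs_two, mul_assoc, mul_assoc 2]
    refine mul_le_mul_of_nonneg_left ?_ zero_le_two
    refine (mul_le_of_le_one_left (abs_nonneg _) (hg _)).trans (h1.trans (le_of_eq (by ring)))
  have h1' : 1 ≤ 4 / π * g 1 := by
    rw [div_mul_eq_mul_div, le_div_iff₀ hpi]; linarith
  obtain ⟨r, hr, v, hv0, hv⟩ := exists_eigenvalue_of_near_diagonal hM (by positivity)
    (a := 3 / 4) (b := 5 / 4) (by norm_num) i₀ (by rw [hD0]; linarith)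
    (fun i hi => by linarith [(_root_.abs_le.1 (hD i hi)).2])
    (fun i => by
      by_cases hi : i = i₀
      · rw [hi, hD0]; linarith
      · linarith [(_root_.abs_le.1 (hD i hi)).2])
  rw [LinearMap.toMatrix'_mulVec] at hv
  refine ⟨r, hr, fun k => ((evenExtend v k : ℝ) : ℂ), ⟨fun k => ?_, ?_, fun k hk => ?_,
    fun n hn hnN => ?_⟩, ?_⟩
  · simp [evenExtend]
  · simp [evenExtend]
  · unfold evenExtend
    rw [dif_neg (by grind), Complex.ofReal_zero]
  · obtain ⟨i, rfl⟩ : ∃ i : Fin N, n = ((i : ℕ) + 1 : ℕ) :=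
      ⟨⟨(n - 1).toNat, by omega⟩, by simp only; omega⟩
    rw [← ofReal_modeSum, evenExtend_succ]
    have := congrFun hv i
    simp only [eigenMap, LinearMap.coe_mk, AddHom.coe_mk, Pi.smul_apply, smul_eq_mul] at this
    exact_mod_cast this.symm
  · by_contra! hz
    refine hv0 (funext fun i => ?_)
    have := hz ((i : ℕ) + 1 : ℕ)
    rw [evenExtend_succ] at this
    exact_mod_cast this

/-- A resolvent estimate for the equations of order at least two. -/
theorem norm_le_of_resolvent (h : IsBranchCoeff N γ ε A) (hg : ∀ n : ℤ, |g n| ≤ 1) {z : ℂ}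
    (hz : 3 / 4 ≤ ‖z‖) {H : ℤ → ℂ} {M r : ℝ} (hM : ∀ k, ‖H k‖ ≤ M) {n : ℤ} (hn : 2 ≤ n)
    (hr : ‖z * H n - 2 * g n * modeSum N A H n‖ ≤ r) :
    ‖H n‖ ≤ 8 * ((2 * N + 1) * ε) * M + 4 * r := by
  have hM0 : 0 ≤ M := (norm_nonneg _).trans (hM 0)
  have h1 := norm_modeSum_le_of_left (N := N) A H n h.zero (B := ε * M)
    (mul_nonneg h.pos.le hM0) (fun k hk =>
      mul_le_mul (h.abs_le k hk) (hM _) (norm_nonneg _) h.pos.le)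
  have hw := two_mul_abs_midWeight_le (n := n) (by rwa [abs_of_nonneg (by omega)])
  have h2 : ‖2 * (g n : ℂ) * modeSum N A H n‖ ≤ 2 * ‖modeSum N A H n‖ := by
    rw [norm_mul, norm_mul, Complex.norm_real, RCLike.norm_ofNat, Real.norm_eq_abs]
    refine mul_le_mul_of_nonneg_right ?_ (norm_nonneg _)
    linarith [hg n]
  have h3 := norm_sub_norm_le (z * H n) (2 * (g n : ℂ) * modeSum N A H n)
  rw [norm_mul] at h3
  -- The diagonal part uses `1/2` of the available `3/4`; dividing by the remaining `1/4` gives the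
  -- factors `8` and `4`.
  have h4 : 3 / 4 * ‖H n‖ ≤ ‖z‖ * ‖H n‖ := mul_le_mul_of_nonneg_right hz (norm_nonneg _)
  have h5 : 2 * |midWeight n| * ‖H n‖ ≤ 1 / 2 * ‖H n‖ :=
    mul_le_mul_of_nonneg_right hw (norm_nonneg _)
  linarith

end IsBranchCoeff

theorem exists_norm_max {N : ℕ} (hN : 1 ≤ N) {H : ℤ → ℂ} (he : ∀ k, H (-k) = H k)
    (h0 : H 0 = 0) (hs : ∀ k : ℤ, (N : ℤ) < |k| → H k = 0) :
    ∃ m : ℤ, 1 ≤ m ∧ m ≤ N ∧ ∀ k, ‖H k‖ ≤ ‖H m‖ := by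
  obtain ⟨m, hm, hmax⟩ := Finset.exists_max_image (Finset.Icc (1 : ℤ) N) (fun k => ‖H k‖)
    ⟨1, Finset.mem_Icc.2 ⟨le_rfl, by omega⟩⟩
  rw [Finset.mem_Icc] at hm
  refine ⟨m, hm.1, hm.2, fun k => ?_⟩
  have habs : H k = H |k| := by
    rcases abs_choice k with hk | hk <;> rw [hk]
    exact (he k).symm
  by_cases hk : (N : ℤ) < |k|
  · rw [hs k hk, norm_zero]; exact norm_nonneg _
  by_cases hk0 : k = 0
  · rw [hk0, h0, norm_zero]; exact norm_nonneg _
  rw [habs]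
  exact hmax _ (Finset.mem_Icc.2 ⟨Int.one_le_abs hk0, not_lt.1 hk⟩)

/-! ### Uniqueness and expansion of the eigenvalue near `1`. -/

namespace IsEigenCoeff

variable {N : ℕ} {γ : ℕ → ℝ} {ε : ℝ} {A : ℤ → ℝ} {g : ℤ → ℝ} {z w : ℂ} {H H' : ℤ → ℂ}

/-- If the largest coefficient had order at least two, the resolvent estimate without source would
bound it by a quarter of itself. -/
theorem norm_le_one (hH : IsEigenCoeff N g A z H) (h : IsBranchCoeff N γ ε A)
    (hg : ∀ n : ℤ, |g n| ≤ 1) (hε : 32 * (2 * N + 1) * ε ≤ 1) (hz : 3 / 4 ≤ ‖z‖) (k : ℤ) :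
    ‖H k‖ ≤ ‖H 1‖ := by
  obtain ⟨m, hm1, hmN, hmax⟩ := exists_norm_max (by have := h.two_le; omega) hH.even hH.zero
    hH.eq_zero
  rcases eq_or_lt_of_le hm1 with rfl | hm
  · exact hmax k
  · have := h.norm_le_of_resolvent hg hz hmax (n := m) (by omega) (r := 0)
      (by rw [hH.equation m hm1 hmN, sub_self, norm_zero])
    have hm0 : ‖H m‖ ≤ 0 := by nlinarith [norm_nonneg (H m)]
    exact (hmax k).trans (hm0.trans (norm_nonneg _))

theorem norm_le (hH : IsEigenCoeff N g A z H) (h : IsBranchCoeff N γ ε A)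
    (hg : ∀ n : ℤ, |g n| ≤ 1) (hε : 32 * (2 * N + 1) * ε ≤ 1) (hz : 3 / 4 ≤ ‖z‖) {k : ℤ}
    (hk : 2 ≤ |k|) : ‖H k‖ ≤ 8 * ((2 * N + 1) * ε) * ‖H 1‖ := by
  have hε0 := h.pos
  have habs : H k = H |k| := by
    rcases abs_choice k with hk | hk <;> rw [hk]
    exact (hH.even k).symm
  rw [habs]
  by_cases hkN : (N : ℤ) < |k|
  · rw [hH.eq_zero _ (by rwa [abs_abs]), norm_zero]; positivity
  · have := h.norm_le_of_resolvent hg hz (hH.norm_le_one h hg hε hz) (n := |k|) hk (r := 0)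
      (by rw [hH.equation _ (by omega) (by omega), sub_self, norm_zero])
    linarith

theorem one_ne_zero (hH : IsEigenCoeff N g A z H) (h : IsBranchCoeff N γ ε A)
    (hg : ∀ n : ℤ, |g n| ≤ 1) (hε : 32 * (2 * N + 1) * ε ≤ 1) (hz : 3 / 4 ≤ ‖z‖)
    (hne : ∃ n, H n ≠ 0) : H 1 ≠ 0 := by
  obtain ⟨n, hn⟩ := hne
  intro h1
  have := hH.norm_le_one h hg hε hz n
  rw [h1, norm_zero] at this
  exact hn (norm_le_zero_iff.1 this)

/-- There is only one eigenvalue outside the disc of radius `3/4`. -/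
theorem unique (hH : IsEigenCoeff N g A z H) (hH' : IsEigenCoeff N g A w H')
    (h : IsBranchCoeff N γ ε A) (hg : ∀ n : ℤ, |g n| ≤ 1) (hε : 32 * (2 * N + 1) * ε ≤ 1)
    (hz : 3 / 4 ≤ ‖z‖) (hw : 3 / 4 ≤ ‖w‖) (hne : ∃ n, H n ≠ 0) (hne' : ∃ n, H' n ≠ 0) :
    z = w := by
  have h1 := hH.one_ne_zero h hg hε hz hne
  have h1' := hH'.one_ne_zero h hg hε hw hne'
  have h2 := h.two_le
  have hε0 := h.pos
  set κ : ℝ := (2 * N + 1) * ε with hκ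
  have hκ0 : 0 ≤ κ := by positivity
  have hκ1 : 32 * κ ≤ 1 := by rw [hκ, ← mul_assoc]; exact hε
  -- This combination has no first mode and solves the system for `z` with source `(w - z) H 1 H'`.
  -- With `t` the norm of the source at order one, the higher equations give `‖G‖ ≤ 64κt` and the
  -- first gives `t ≤ 2κ‖G‖`. Thus `t ≤ 128κ²t ≤ t/8`, so `t = 0`.
  let G : ℤ → ℂ := fun k => H' 1 * H k - H 1 * H' k
  have hsum : ∀ n, modeSum N A G n = H' 1 * modeSum N A H n - H 1 * modeSum N A H' n := by
    intro n
    simp only [G]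
    rw [modeSum_sub_right]
    unfold modeSum
    rw [Finset.mul_sum, Finset.mul_sum]
    congr 1 <;> exact Finset.sum_congr rfl fun k _ => (mul_smul_comm _ _ _).symm
  have hG1 : G 1 = 0 := by simp only [G]; ring
  have hGeq : ∀ n : ℤ, 1 ≤ n → n ≤ N →
      z * G n - 2 * g n * modeSum N A G n = (w - z) * (H 1 * H' n) := by
    intro n hn hnN
    rw [hsum]
    simp only [G]
    linear_combination H' 1 * hH.equation n hn hnN - H 1 * hH'.equation n hn hnN
  obtain ⟨m, hm1, hmN, hmax⟩ := exists_norm_max (N := N) (by omega) (H := G)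
    (fun k => by simp only [G, hH.even, hH'.even]) (by simp only [G, hH.zero, hH'.zero]; ring)
    (fun k hk => by simp only [G, hH.eq_zero k hk, hH'.eq_zero k hk]; ring)
  set t := ‖w - z‖ * (‖H 1‖ * ‖H' 1‖) with ht
  have hM : ‖G m‖ ≤ 64 * κ * t := by
    rcases eq_or_lt_of_le hm1 with rfl | hm
    · rw [hG1, norm_zero]; positivity
    · have hr : ‖z * G m - 2 * g m * modeSum N A G m‖ ≤ 8 * κ * t := by
        rw [hGeq m hm1 hmN, norm_mul, norm_mul, ht]
        have := hH'.norm_le h hg hε hw (k := m) (by rw [abs_of_nonneg] <;> omega)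
        calc ‖w - z‖ * (‖H 1‖ * ‖H' m‖) ≤ ‖w - z‖ * (‖H 1‖ * (8 * κ * ‖H' 1‖)) := by gcongr
          _ = _ := by ring
      have := h.norm_le_of_resolvent hg hz hmax (n := m) (by omega) hr
      rw [← hκ] at this
      have := mul_le_mul_of_nonneg_right hκ1 (norm_nonneg (G m))
      have : 0 ≤ κ * t := by positivity
      linarith
  have h3 := hGeq 1 le_rfl (by omega)
  rw [hG1, mul_zero, zero_sub] at h3
  have h4 : t ≤ 2 * (κ * ‖G m‖) := by
    have h5 : t = ‖2 * (g 1 : ℂ) * modeSum N A G 1‖ := by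
      rw [← norm_neg, h3, norm_mul, norm_mul]
    have h6 := norm_modeSum_le_of_left (N := N) A G 1 h.zero (B := ε * ‖G m‖)
      (by positivity) (fun k hk =>
        mul_le_mul (h.abs_le k hk) (hmax _) (norm_nonneg _) hε0.le)
    rw [hG1, norm_zero, mul_zero, zero_add, ← mul_assoc, ← hκ] at h6
    rw [h5, norm_mul, norm_mul, Complex.norm_real, RCLike.norm_ofNat, Real.norm_eq_abs]
    have h7 := mul_le_of_le_one_left (norm_nonneg (modeSum N A G 1)) (hg 1)
    linarith
  have h8 : κ * ‖G m‖ ≤ κ * (64 * κ * t) := mul_le_mul_of_nonneg_left hM hκ0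
  have ht0 : 0 ≤ t := by positivity
  have h9 : 1024 * κ ^ 2 ≤ 1 := by nlinarith
  have h10 : t ≤ 0 := by nlinarith [mul_le_mul_of_nonneg_right h9 ht0]
  have h11 : t = 0 := le_antisymm h10 ht0
  rw [ht, mul_eq_zero, mul_eq_zero, norm_eq_zero, norm_eq_zero, norm_eq_zero] at h11
  rcases h11 with h11 | h11 | h11
  · exact (sub_eq_zero.1 h11).symm
  · exact absurd h11 h1
  · exact absurd h11 h1'

theorem coeff_two (hH : IsEigenCoeff N g A z H) (h : IsBranchCoeff N γ ε A) :
    z * H 2 = 2 * g 2 * (ε * H 1) := by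
  have h2 := h.two_le
  have h3 := modeSum_two_mul N A H (m := 1) (by simp; omega)
  rw [h.one, Complex.real_smul, mul_one] at h3
  rw [hH.equation 2 (by norm_num) (by omega), h3]

/-- Expansion of the eigenvalue along the branch. -/
theorem norm_sub_le (hH : IsEigenCoeff N g A z H) (h : IsBranchCoeff N γ ε A)
    (hg : ∀ n : ℤ, |g n| ≤ 1) (hε : 32 * (2 * N + 1) * ε ≤ 1) (hz : 3 / 4 ≤ ‖z‖)
    (hne : ∃ n, H n ≠ 0) (hg2 : g 2 = γ 2) :
    ‖z - ((4 / π * g 1 : ℝ) : ℂ) + ((4 * g 1 / (3 * π) * γ 2 * ε ^ 2 : ℝ) : ℂ) * (2 / z + 1)‖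
      ≤ 32 * (2 * N + 1) ^ 3 * ε ^ 3 := by
  have h1 := hH.one_ne_zero h hg hε hz hne
  have hε0 := h.pos
  have h2 := h.two_le
  have hz0 : z ≠ 0 := by rintro rfl; norm_num at hz
  have hpi : (π : ℂ) ≠ 0 := by exact_mod_cast pi_ne_zero
  -- The term `k = 1` vanishes because `H 0 = 0`. All terms outside this set pair an `O(ε²)`
  -- coefficient of `A` with an `O(ε)` coefficient of `H`.
  have hmem : ({0, 1, 2, -1} : Finset ℤ) ⊆ Finset.Icc (-(N : ℤ)) N := by
    intro k hk
    simp only [Finset.mem_insert, Finset.mem_singleton] at hk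
    rw [Finset.mem_Icc]; omega
  have h3 := norm_modeSum_sub_sum_le (N := N) A H 1 hmem
    (B := 2 * (2 * N + 1) * ε ^ 2 * (8 * ((2 * N + 1) * ε) * ‖H 1‖)) (by positivity)
    (fun k hk => by
      simp only [Finset.mem_insert, Finset.mem_singleton, not_or] at hk
      exact mul_le_mul (h.abs_le_sq (by grind)) (hH.norm_le h hg hε hz (by grind))
        (norm_nonneg _) (by positivity))
  rw [Finset.sum_insert (by decide), Finset.sum_insert (by decide), Finset.sum_insert (by decide),
    Finset.sum_singleton] at h3
  have hm1 : A (-1) = ε := by rw [h.even, h.one]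
  have hHm1 : H (-1) = H 1 := hH.even 1
  have w3 : midWeight (-3) = -(2 / (3 * π)) := by rw [midWeight_neg, midWeight_three]
  norm_num [h.zero, h.one, hm1, w3, midWeight_one, midWeight_three, h.coeff_two, hH.zero, hHm1,
    -midWeight_zero] at h3
  set R := modeSum N A H 1
  -- The exact second equation eliminates `H 2` and is the source of the term `2 / z`.
  have hH2 : H 2 = 2 * γ 2 * ε * H 1 / z := by
    rw [eq_div_iff hz0, mul_comm, hH.coeff_two h, hg2]; ring
  have hz1 := hH.equation 1 le_rfl (by omega)
  have key : (z - ((4 / π * g 1 : ℝ) : ℂ)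
      + ((4 * g 1 / (3 * π) * γ 2 * ε ^ 2 : ℝ) : ℂ) * (2 / z + 1)) * H 1
      = 2 * g 1 * (R - (2 / π * H 1 + (-(2 / (3 * π) * (γ 2 * ε ^ 2) * H 1)
        + -(2 / (3 * π) * ε * H 2)))) := by
    rw [hH2]
    push_cast
    field_simp
    field_simp at hz1
    linear_combination (3 * π * z) * hz1
  have hpos : 0 < ‖H 1‖ := norm_pos_iff.2 h1
  rw [← mul_le_mul_iff_left₀ hpos, ← norm_mul, key, norm_mul, norm_mul, Complex.norm_real,
    RCLike.norm_ofNat, Real.norm_eq_abs, mul_assoc]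
  have h4 := mul_le_of_le_one_left (norm_nonneg (R - (2 / π * H 1
    + (-(2 / (3 * π) * (γ 2 * ε ^ 2) * H 1) + -(2 / (3 * π) * ε * H 2))))) (hg 1)
  linarith

end IsEigenCoeff

end CircleAlignment

namespace CircleAlignment

/-! ### The uniform profile -/

section uniform

variable {N : ℕ}

theorem uniform_eq_cosPoly : uniform = cosPoly N 0 fun _ => 0 := by
  have h : uniform.toFun = (cosPoly N 0 fun _ => 0).toFun := by
    funext x; simp [uniform, cosPoly]
  generalize cosPoly N 0 (fun _ => 0) = f at h
  cases f
  simp only at h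
  subst h
  rfl

theorem cosCoeff_uniform {k : ℤ} (hk : k ≠ 0) : cosCoeff N 0 (fun _ => 0) k = 0 := by
  simp [cosCoeff, hk]

theorem modeSum_uniform {E : Type*} [NormedAddCommGroup E] [NormedSpace ℝ E] (H : ℤ → E) (n : ℤ) :
    modeSum N (cosCoeff N 0 fun _ => 0) H n = midWeight n • H n := by
  unfold modeSum
  rw [Finset.sum_eq_single 0 (fun k _ hk => by rw [cosCoeff_uniform hk, mul_zero, zero_smul])
    (fun h => absurd (Finset.mem_Icc.2 (by omega)) h)]
  simp

theorem isStationary_uniform (h2 : 2 ≤ N) (s : ℝ) (γ : ℕ → ℝ) :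
    IsStationary (cosPoly N s γ) uniform := by
  rw [uniform_eq_cosPoly (N := N)]
  refine isStationary_cosPoly h2 fun n hn _ => ?_
  rw [modeSum_uniform, cosCoeff_uniform (by omega), smul_zero, mul_zero]

theorem abs_cosCoeff_le_one {s : ℝ} {γ : ℕ → ℝ} (hs0 : 0 ≤ s) (hs1 : s ≤ 1)
    (hγ : ∀ k ∈ Finset.Icc 2 N, |γ k| ≤ 1) (n : ℤ) : |cosCoeff N s γ n| ≤ 1 := by
  unfold cosCoeff
  split_ifs with h0 h1 hN
  · simp
  · rwa [abs_of_nonneg hs0]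
  · exact hγ _ (Finset.mem_Icc.2 ⟨by omega, hN⟩)
  · simp

/-- The gain derivative is diagonal on modes with real entries `2 g_n w(n)`, all below `1` when
`4s/π < 1`. The spectral point `0` of the gain derivative, not covered by the finite-rank argument,
corresponds to `z = -1` and is harmless. -/
theorem isStableGenerator_uniform (h2 : 2 ≤ N) {s : ℝ} {γ : ℕ → ℝ} (hs0 : 0 ≤ s)
    (hs : s < π / 4) (hγ : ∀ k ∈ Finset.Icc 2 N, |γ k| ≤ 1) :
    IsStableGenerator (linearization (cosPoly N s γ) uniform) := by
  intro z hz
  have hz1 := mem_spectrum_sub_one hz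
  by_cases h0 : z + 1 = 0
  · rw [eq_neg_of_add_eq_zero_left h0]; simp
  rw [uniform_eq_cosPoly (N := N)] at hz1
  obtain ⟨h, hh, hN, heq, n, hn⟩ := exists_fourierExp_of_mem_spectrum h2 le_rfl _ h0 hz1
  have hnN : |n| ≤ N := by
    by_contra hlt
    exact hn (hN n (not_le.1 hlt))
  have hn0 : n ≠ 0 := by
    rintro rfl
    exact hn ((fourierExp_zero h).trans hh.2.2)
  have h3 := heq n hnN
  rw [modeSum_uniform, Complex.real_smul, ← mul_assoc] at h3
  have h4 : z + 1 = ((2 * cosCoeff N s γ n * midWeight n : ℝ) : ℂ) := by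
    push_cast; exact mul_right_cancel₀ hn h3
  have h5 : 2 * cosCoeff N s γ n * midWeight n < 1 := by
    have hpi := pi_pos
    rcases eq_or_lt_of_le (Int.one_le_abs hn0) with h1 | h1
    · have e : cosCoeff N s γ n = s ∧ midWeight n = 2 / π := by
        rcases abs_eq (zero_le_one) |>.1 h1.symm with rfl | rfl
        · exact ⟨cosCoeff_one, midWeight_one⟩
        · rw [cosCoeff_neg, midWeight_neg]; exact ⟨cosCoeff_one, midWeight_one⟩
      rw [e.1, e.2, mul_div_assoc', div_lt_one hpi]; linarith
    · have hw := two_mul_abs_midWeight_le (n := n) (by omega)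
      have hg := abs_cosCoeff_le_one hs0 (by linarith [pi_le_four]) hγ n
      have h6 : 2 * cosCoeff N s γ n * midWeight n ≤ |2 * cosCoeff N s γ n * midWeight n| :=
        le_abs_self _
      rw [abs_mul, abs_mul, abs_two] at h6
      have h7 := mul_le_of_le_one_left (abs_nonneg (midWeight n)) hg
      linarith
  have h8 := congrArg Complex.re h4
  rw [Complex.ofReal_re, Complex.add_re, Complex.one_re] at h8
  linarith

theorem hasEigenvalue_sub_one {V : Type*} [AddCommGroup V] [Module ℂ V] {T : Module.End ℂ V}
    {z : ℂ} (hz : T.HasEigenvalue z) : (T - 1).HasEigenvalue (z - 1) := by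
  obtain ⟨v, hv⟩ := hz.exists_hasEigenvector
  refine Module.End.hasEigenvalue_of_hasEigenvector (x := v) ⟨?_, hv.2⟩
  rw [Module.End.mem_eigenspace_iff, LinearMap.sub_apply, hv.apply_eq_smul, Module.End.one_apply,
    sub_smul, one_smul]

/-- The perturbation `2 cos x` is an eigenfunction of the gain derivative with eigenvalue `4s/π >
1`. -/
theorem isUnstableGenerator_uniform (h2 : 2 ≤ N) {s : ℝ} {γ : ℕ → ℝ} (hs : π / 4 < s) :
    IsUnstableGenerator (evenLinearization (cosPoly N s γ) uniform) := by
  have hpi := pi_pos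
  refine ⟨((4 / π * s : ℝ) : ℂ) - 1, hasEigenvalue_sub_one ?_, ?_⟩
  · rw [uniform_eq_cosPoly (N := N)]
    refine hasEigenvalue_evenGainDeriv h2 (H := fun k => if k.natAbs = 1 then 1 else 0)
      (by simp) (by simp) (fun k hk => if_neg (by grind)) (m := 1) (by simp) fun n hn _ => ?_
    rw [modeSum_uniform]
    by_cases h1 : n = 1
    · subst h1
      simp [midWeight_one]; ring
    · rw [if_neg (by omega)]; simp
  · rw [Complex.sub_re, Complex.ofReal_re, Complex.one_re, sub_pos, div_mul_eq_mul_div,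
      one_lt_div hpi]
    linarith

end uniform

/-! ### The bifurcating branch -/

/-- All nonconstant coefficients are at most `ε` and `(2N+1)ε ≤ 1/8`, so the constant `1` dominates.
-/
theorem cosPoly_nonneg {N : ℕ} {γ : ℕ → ℝ} {ε : ℝ} {c : ℕ → ℝ}
    (h : IsBranchCoeff N γ ε (cosCoeff N ε c)) (x : ℝ) : 0 ≤ cosPoly N ε c x := by
  have hε := h.pos
  have hK := h.mul_le
  have h2 := h.two_le
  have hterm : ∀ k ∈ Finset.Icc 2 N, -ε ≤ c k * Real.cos (k * x) := by
    intro k hk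
    rw [Finset.mem_Icc] at hk
    have h1 := h.abs_le k (by omega)
    rw [cosCoeff_of_two_le (by omega) (by omega), Int.natAbs_natCast] at h1
    have h3 : |c k * Real.cos (k * x)| ≤ ε := by
      rw [abs_mul]
      exact (mul_le_of_le_one_right (abs_nonneg _) (Real.abs_cos_le_one _)).trans h1
    exact (abs_le.1 h3).1
  have hsum := Finset.card_nsmul_le_sum _ _ _ hterm
  rw [nsmul_eq_mul, Nat.card_Icc, show N + 1 - 2 = N - 1 by omega, Nat.cast_sub (by omega)] at hsum
  have hcos : -ε ≤ ε * Real.cos x := by nlinarith [Real.neg_one_le_cos x]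
  change 0 ≤ 1 + 2 * ε * Real.cos x + 2 * ∑ k ∈ Finset.Icc 2 N, c k * Real.cos (k * x)
  push_cast at hsum
  linarith

/-- If the noise and the profile satisfy the smallness conditions, the eigenvalue found close to
`1` is leading. -/
theorem isLeadingEigenvalue_of_isBranchCoeff {N : ℕ} {γ : ℕ → ℝ} {ε s : ℝ} {c : ℕ → ℝ}
    (h : IsBranchCoeff N γ ε (cosCoeff N ε c)) (hs0 : 0 ≤ s) (hs1 : s ≤ 1)
    (hε : 32 * (2 * N + 1) * ε ≤ 1) {r : ℝ} (hr : 3 / 4 ≤ r) {H : ℤ → ℂ}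
    (hH : IsEigenCoeff N (cosCoeff N s γ) (cosCoeff N ε c) r H) (hne : ∃ n, H n ≠ 0) :
    IsLeadingEigenvalue (evenGainDeriv (cosPoly N s γ) (cosPoly N ε c)) r := by
  obtain ⟨m, hm⟩ := hne
  refine ⟨hasEigenvalue_evenGainDeriv h.two_le hH.even hH.zero hH.eq_zero hm hH.equation,
    fun z hz hzr => ?_⟩
  by_contra! hle
  have hz0 : z ≠ 0 := by
    rintro rfl
    rw [norm_zero] at hle
    linarith
  obtain ⟨u, hu, hN, heq, hne⟩ := exists_fourierExp_of_mem_spectrum h.two_le _ _ hz0 hz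
  have hE : IsEigenCoeff N (cosCoeff N s γ) (cosCoeff N ε c) z (fourierExp u) :=
    ⟨fourierExp_neg hu.2, (fourierExp_zero u).trans hu.1.2.2, hN,
      fun n hn hnN => heq n (by rwa [abs_of_nonneg (by omega)])⟩
  refine hzr (hE.unique hH h (abs_cosCoeff_le_one hs0 hs1 h.noise_le) hε (hr.trans hle) ?_ hne
    ⟨m, hm⟩)
  rwa [Complex.norm_real, Real.norm_eq_abs, abs_of_nonneg (by linarith)]

theorem isStableGenerator_of_isLeadingEigenvalue {V : Type*} [AddCommGroup V] [Module ℂ V]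
    {T : Module.End ℂ V} {r : ℝ} (h : IsLeadingEigenvalue T r) (hr : r < 1) :
    IsStableGenerator (T - 1) := by
  intro z hz
  have h1 : (z + 1).re < 1 := by
    by_cases h2 : z + 1 = r
    · rwa [h2, Complex.ofReal_re]
    · exact (Complex.re_le_norm _).trans_lt ((h.2 _ (mem_spectrum_sub_one hz) h2).trans hr)
  rw [Complex.add_re, Complex.one_re] at h1
  linarith

/-- Elimination of the profile from the expansions of its first stationarity equation and of the
eigenvalue. -/
theorem eigenvalue_estimate {r d P K ε : ℝ} (hr : r ∈ Set.Icc (3 / 4 : ℝ) (5 / 4)) (hK : 1 ≤ K)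
    (hε0 : 0 ≤ ε) (hε1 : ε ≤ 1) (hP0 : 0 ≤ P) (hP : P ≤ ε ^ 2 / 2)
    (hd : |d - P| ≤ 8 * K ^ 4 * ε ^ 4)
    (h : |r - (1 + d) + P * (2 / r + 1)| ≤ 32 * K ^ 3 * ε ^ 3) :
    |r - (1 - 2 * d)| ≤ 120 * K ^ 4 * ε ^ 3 := by
  have hr0 : 0 < r := by linarith [hr.1]
  have hK4 : 1 ≤ K ^ 4 := one_le_pow₀ hK
  have hK34 : K ^ 3 ≤ K ^ 4 := pow_le_pow_right₀ hK (by norm_num)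
  have hε32 : ε ^ 3 ≤ ε ^ 2 := pow_le_pow_of_le_one hε0 hε1 (by norm_num)
  have hε42 : ε ^ 4 ≤ ε ^ 2 := pow_le_pow_of_le_one hε0 hε1 (by norm_num)
  have hε43 : ε ^ 4 ≤ ε ^ 3 := pow_le_pow_of_le_one hε0 hε1 (by norm_num)
  have e1 : K ^ 4 * ε ^ 4 ≤ K ^ 4 * ε ^ 3 := mul_le_mul_of_nonneg_left hε43 (by positivity)
  have e2 : K ^ 4 * ε ^ 4 ≤ K ^ 4 * ε ^ 2 := mul_le_mul_of_nonneg_left hε42 (by positivity)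
  have e3 : K ^ 3 * ε ^ 3 ≤ K ^ 4 * ε ^ 3 := mul_le_mul_of_nonneg_right hK34 (by positivity)
  have e4 : K ^ 4 * ε ^ 3 ≤ K ^ 4 * ε ^ 2 := mul_le_mul_of_nonneg_left hε32 (by positivity)
  have e5 : ε ^ 2 ≤ K ^ 4 * ε ^ 2 := le_mul_of_one_le_left (by positivity) hK4
  have hinv : 2 / r ≤ 8 / 3 := by rw [div_le_div_iff₀ hr0 (by norm_num)]; linarith [hr.1]
  have hinv0 : 0 ≤ 2 / r := by positivity
  have hPr : P * (2 / r + 1) ≤ ε ^ 2 / 2 * (8 / 3 + 1) :=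
    mul_le_mul hP (by linarith) (by linarith) (by positivity)
  have hPr0 : 0 ≤ P * (2 / r + 1) := mul_nonneg hP0 (by linarith)
  obtain ⟨hd1, hd2⟩ := abs_le.1 hd
  obtain ⟨h1, h2⟩ := abs_le.1 h
  -- Bootstrap: the crude bound `r = 1 + O(ε²)` allows `P(2/r)` to be replaced by `2P` at the cost
  -- of `O(ε⁴)`.
  have hr1 : |r - 1| ≤ 43 * (K ^ 4 * ε ^ 2) := by
    rw [abs_le]; constructor <;> linarith
  have h3 : |P * (2 - 2 / r)| ≤ 58 * (K ^ 4 * ε ^ 4) := by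
    rw [show P * (2 - 2 / r) = P * (2 / r) * (r - 1) by field_simp, abs_mul,
      abs_of_nonneg (mul_nonneg hP0 hinv0)]
    have h4 : P * (2 / r) ≤ ε ^ 2 / 2 * (8 / 3) := mul_le_mul hP hinv hinv0 (by positivity)
    have h5 : 0 ≤ K ^ 4 * ε ^ 4 := by positivity
    calc P * (2 / r) * |r - 1| ≤ ε ^ 2 / 2 * (8 / 3) * (43 * (K ^ 4 * ε ^ 2)) := by gcongr
      _ = 172 / 3 * (K ^ 4 * ε ^ 4) := by ring
      _ ≤ _ := by linarith
  obtain ⟨h6, h7⟩ := abs_le.1 h3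
  have e6 : 0 ≤ K ^ 4 * ε ^ 3 := by positivity
  rw [abs_le]
  constructor <;> linarith

/-- Expansion of the amplitude of the branch. -/
theorem amplitude_estimate {ε δ q b s L X : ℝ} (hq : 0 < q) (hb : |b| ≤ 1) (hδ : 0 < δ)
    (hs : s = π / 4 + δ) (hbq : |b - q| ≤ L * δ) (hX : 0 ≤ X) (hε : √δ ≤ ε)
    (hε' : ε ^ 2 ≤ 12 * δ / q)
    (h : |4 / π * δ - 4 * s / (3 * π) * b * ε ^ 2| ≤ X * ε ^ 4) :
    |ε - √(12 * δ / (π * q))|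
      ≤ 3 / q * ((L / 3 + 1) * (12 / q) + X * (12 / q) ^ 2) * (δ * √δ) := by
  have hpi := pi_pos
  have hL : 0 ≤ L * δ := (abs_nonneg _).trans hbq
  have hsq : 0 < √δ := Real.sqrt_pos.2 hδ
  have hsq2 : √δ * √δ = δ := Real.mul_self_sqrt hδ.le
  set τ := √(12 * δ / (π * q))
  have hτ0 : 0 ≤ τ := Real.sqrt_nonneg _
  have hτ : τ ^ 2 = 12 * δ / (π * q) := Real.sq_sqrt (by positivity)
  -- The cubic coefficient tends to `q/3` at the critical parameter, and `τ²` is `(4δ/π)/(q/3)`.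
  have hsb : 4 * s / (3 * π) * b = b / 3 + 4 / (3 * π) * δ * b := by
    rw [hs]; field_simp
  have hpi3 : 4 / (3 * π) ≤ 1 := by rw [div_le_one (by positivity)]; linarith [pi_gt_three]
  have h1 : |(q / 3 - 4 * s / (3 * π) * b) * ε ^ 2| ≤ (L / 3 + 1) * δ * (12 * δ / q) := by
    rw [abs_mul, abs_of_nonneg (sq_nonneg ε)]
    refine mul_le_mul ?_ hε' (sq_nonneg _) (by linarith)
    have h2 : |4 / (3 * π) * δ * b| ≤ 1 * δ * 1 := by
      rw [abs_mul, abs_of_nonneg (by positivity : 0 ≤ 4 / (3 * π) * δ)]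
      gcongr
    rw [hsb]
    obtain ⟨h3, h4⟩ := abs_le.1 h2
    obtain ⟨h5, h6⟩ := abs_le.1 hbq
    rw [abs_le]; constructor <;> linarith
  have h2 : X * ε ^ 4 ≤ X * (12 * δ / q) ^ 2 := by
    rw [show ε ^ 4 = (ε ^ 2) ^ 2 by ring]
    gcongr
  have h3 : |ε ^ 2 - τ ^ 2| ≤ 3 / q * ((L / 3 + 1) * (12 / q) + X * (12 / q) ^ 2) * δ ^ 2 := by
    have e : ε ^ 2 - τ ^ 2 = 3 / q * ((q / 3 - 4 * s / (3 * π) * b) * ε ^ 2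
        - (4 / π * δ - 4 * s / (3 * π) * b * ε ^ 2)) := by
      rw [hτ]; field_simp; ring
    have hq3 : 0 < 3 / q := by positivity
    rw [e, abs_mul, abs_of_pos hq3, mul_assoc (3 / q)]
    refine mul_le_mul_of_nonneg_left ?_ hq3.le
    refine (abs_sub _ _).trans ((add_le_add h1 (h.trans h2)).trans (le_of_eq ?_))
    field_simp
  -- Dividing `ε² - τ² = O(δ²)` by `ε + τ ≥ √δ` gives the order `δ^{3/2}`.
  have h4 : |ε - τ| * √δ ≤ |ε ^ 2 - τ ^ 2| := by
    rw [show ε ^ 2 - τ ^ 2 = (ε - τ) * (ε + τ) by ring, abs_mul]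
    exact mul_le_mul_of_nonneg_left ((by linarith : √δ ≤ ε + τ).trans (le_abs_self _))
      (abs_nonneg _)
  refine le_of_mul_le_mul_right ((h4.trans h3).trans (le_of_eq ?_)) hsq
  linear_combination
    (-(3 / q * ((L / 3 + 1) * (12 / q) + X * (12 / q) ^ 2) * δ)) * hsq2

end CircleAlignment

/-! ### Explicit estimates near the critical parameter, and assembly. -/

namespace CircleAlignment

/-- Consequences of the smallness of the distance `δ` to the critical parameter. -/
theorem smallness {K q δ ε : ℝ} (hK : 1 ≤ K) (hq : 0 < q) (hq1 : q ≤ 1) (hδ : 0 < δ)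
    (h : 10 ^ 7 * K ^ 8 * δ ≤ q ^ 3) (hε : 0 < ε) (hε' : ε ^ 2 ≤ 12 * δ / q) :
    δ ≤ 1 / 100 ∧ 2000 * K ^ 4 * δ ≤ q ^ 2 ∧ 720 * (K ^ 4 * ε) < q ∧ 32 * K * ε ≤ 1 := by
  have hK4 : 1 ≤ K ^ 4 := one_le_pow₀ hK
  have hK14 : K ≤ K ^ 4 := le_self_pow₀ hK (by norm_num)
  have hK8 : K ^ 4 ≤ K ^ 8 := pow_le_pow_right₀ hK (by norm_num)
  have h1 : K ^ 4 * δ ≤ K ^ 8 * δ := mul_le_mul_of_nonneg_right hK8 hδ.le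
  have h2 : δ ≤ K ^ 4 * δ := le_mul_of_one_le_left hδ.le hK4
  have hq3 : q ^ 3 ≤ q ^ 2 := pow_le_pow_of_le_one hq.le hq1 (by norm_num)
  have hq2 : q ^ 2 ≤ 1 := pow_le_one₀ hq.le hq1
  have h3 : 720 * (K ^ 4 * ε) < q := by
    refine lt_of_pow_lt_pow_left₀ 2 hq.le ?_
    -- This is the binding condition: `720² · 12 < 10⁷`, and it dictates the powers `K⁸` and `q³` in
    -- the hypothesis.
    calc (720 * (K ^ 4 * ε)) ^ 2 = 518400 * K ^ 8 * ε ^ 2 := by ring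
      _ ≤ 518400 * K ^ 8 * (12 * δ / q) := by gcongr
      _ = 6220800 * K ^ 8 * δ / q := by ring
      _ < 10 ^ 7 * K ^ 8 * δ / q := by
        have : 0 < K ^ 8 * δ := by positivity
        rw [div_lt_div_iff_of_pos_right hq]; linarith
      _ ≤ q ^ 3 / q := by gcongr
      _ = q ^ 2 := by field_simp
  have h4 : K * ε ≤ K ^ 4 * ε := mul_le_mul_of_nonneg_right hK14 hε.le
  exact ⟨by linarith, by linarith, h3, by linarith⟩

/-- The non-uniform stationary density at a parameter `s` close to the critical one, with explicit
estimates. -/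
theorem exists_stationary_near_critical {N : ℕ} (h2 : 2 ≤ N) {γ : ℕ → ℝ}
    (hγ : ∀ k ∈ Finset.Icc 2 N, |γ k| ≤ 1) {q L s K : ℝ} (hKN : K = 2 * N + 1) (hq : 0 < q)
    (hq1 : q ≤ 1) (hs0 : π / 4 < s) (hs1 : s ≤ 1) (hqγ : q / 2 ≤ γ 2)
    (hL : |γ 2 - q| ≤ L * (s - π / 4)) (hδ : 10 ^ 7 * K ^ 8 * (s - π / 4) ≤ q ^ 3) :
    ∃ (f : EvenProfile) (r : ℝ), (∀ x, 0 ≤ f x) ∧ IsStationary (cosPoly N s γ) f ∧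
      0 < fourierCos f 1 ∧ (∀ k, N < k → fourierCos f k = 0) ∧
      IsStableGenerator (evenLinearization (cosPoly N s γ) f) ∧
      IsLeadingEigenvalue (evenGainDeriv (cosPoly N s γ) f) r ∧
      √(s - π / 4) ≤ fourierCos f 1 ∧ fourierCos f 1 ≤ √(12 / q) * √(s - π / 4) ∧
      |fourierCos f 1 - √(12 * (s - π / 4) / (π * q))|
        ≤ 3 / q * ((L / 3 + 1) * (12 / q) + 8 * K ^ 4 * (12 / q) ^ 2)
          * ((s - π / 4) * √(s - π / 4)) ∧
      |r - (1 - 8 / π * (s - π / 4))|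
        ≤ 120 * K ^ 4 * √(12 / q) ^ 3 * ((s - π / 4) * √(s - π / 4)) := by
  have hpi := pi_pos
  have hK : 1 ≤ K := by rw [hKN]; linarith [(Nat.cast_nonneg N : (0 : ℝ) ≤ N)]
  set δ := s - π / 4 with hδdef
  have hδ0 : 0 < δ := sub_pos.2 hs0
  have hs : s = π / 4 + δ := by rw [hδdef]; ring
  have hspos : 0 < s := by linarith
  -- The amplitude is not known yet; its largest admissible value is inserted only to extract the
  -- condition on `δ`.
  have hδ' := (smallness hK hq hq1 hδ0 hδ (Real.sqrt_pos.2 (by positivity : 0 < 12 * δ / q))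
    (Real.sq_sqrt (by positivity)).le).2.1
  rw [hKN] at hδ'
  obtain ⟨ε, hε, c, hbr, hst⟩ := exists_branchCoeff_stationary h2 hγ hq hqγ hq1 hs0 hs1 hδ'
  have hε0 := hbr.pos
  have hεsq : ε ^ 2 ≤ 12 * δ / q :=
    (Real.le_sqrt hε0.le (by positivity)).1 hε.2
  obtain ⟨hδ100, -, hKε, h32⟩ := smallness hK hq hq1 hδ0 hδ hε0 hεsq
  have hexp := hbr.abs_mul_modeSum_sub_le hspos.le hs1
  rw [← hst, sub_self, zero_sub, abs_neg, abs_mul, abs_of_pos hε0, ← hKN, ← hδdef] at hexp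
  replace hexp := le_of_mul_le_mul_left hexp hε0
  have hg := abs_cosCoeff_le_one hspos.le hs1 hγ
  have hγ2 : |γ 2| ≤ 1 := hγ 2 (Finset.mem_Icc.2 ⟨le_rfl, h2⟩)
  have hg2 : cosCoeff N s γ 2 = γ 2 := cosCoeff_of_two_le le_rfl (by omega)
  have h4s : 4 / π * s = 1 + 4 / π * δ := by rw [hs]; field_simp
  have h4pi : 4 / π ≤ 4 / 3 := div_le_div_of_nonneg_left (by norm_num) (by norm_num)
    pi_gt_three.le
  have h4δ : 4 / π * δ ≤ 4 / 3 * (1 / 100) := mul_le_mul h4pi hδ100 hδ0.le (by norm_num)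
  obtain ⟨r, hr, H, hH, hne⟩ := hbr.exists_real_isEigenCoeff hg (by rwa [← hKN])
    (by rw [cosCoeff_one]; exact hs0.le) (by rw [cosCoeff_one, h4s]; linarith)
  have hlead := isLeadingEigenvalue_of_isBranchCoeff hbr hspos.le hs1 (by rwa [← hKN]) hr.1 hH hne
  have hfour : fourierCos (cosPoly N ε c) 1 = ε := by
    rw [fourierCos_cosPoly h2, Nat.cast_one, cosCoeff_one]
  have hrexp := hH.norm_sub_le hbr hg (by rwa [← hKN])
    (by rw [Complex.norm_real, Real.norm_eq_abs, abs_of_nonneg (by linarith [hr.1])]; exact hr.1)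
    hne hg2
  rw [cosCoeff_one, ← hKN, h4s] at hrexp
  have hrexp' : |r - (1 + 4 / π * δ) + 4 * s / (3 * π) * γ 2 * ε ^ 2 * (2 / r + 1)|
      ≤ 32 * K ^ 3 * ε ^ 3 := by
    rw [← Real.norm_eq_abs, ← Complex.norm_real]
    exact_mod_cast hrexp
  have hε1 : ε ≤ 1 := by nlinarith
  have hP : 4 * s / (3 * π) * γ 2 * ε ^ 2 ≤ ε ^ 2 / 2 := by
    have h1 : 4 * s / (3 * π) ≤ 1 / 2 := by
      rw [div_le_div_iff₀ (by positivity) (by norm_num)]; linarith [pi_gt_three]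
    have h3 : 4 * s / (3 * π) * γ 2 ≤ 1 / 2 * 1 :=
      mul_le_mul h1 ((le_abs_self _).trans hγ2) (by linarith) (by norm_num)
    nlinarith [sq_nonneg ε]
  have hP0 : 0 ≤ 4 * s / (3 * π) * γ 2 * ε ^ 2 :=
    mul_nonneg (mul_nonneg (by positivity) (by linarith)) (sq_nonneg _)
  have hrest := eigenvalue_estimate hr hK hε0.le hε1 hP0 hP hexp hrexp'
  have h8 : 2 * (4 / π * δ) = 8 / π * δ := by ring
  rw [h8] at hrest
  have hsqrt : √(12 * δ / q) = √(12 / q) * √δ := by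
    rw [← Real.sqrt_mul (by positivity)]; congr 1; ring
  -- The condition `720 K⁴ε < q` makes the error `120 K⁴ε³` smaller than `2δ`, while the eigenvalue
  -- drops by `8δ/π ≥ 2δ`.
  have hr1 : r < 1 := by
    have h5 : 120 * K ^ 4 * ε ^ 3 < 2 * δ := by
      calc 120 * K ^ 4 * ε ^ 3 = 120 * (K ^ 4 * ε) * ε ^ 2 := by ring
        _ ≤ 120 * (K ^ 4 * ε) * (12 * δ / q) := by gcongr
        _ = 720 * (K ^ 4 * ε) * (2 * δ / q) := by ring
        _ < q * (2 * δ / q) := by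
          have : 0 < 2 * δ / q := by positivity
          gcongr
        _ = 2 * δ := by field_simp
    have h6 : 2 * δ ≤ 8 / π * δ := by
      refine mul_le_mul_of_nonneg_right ?_ hδ0.le
      rw [le_div_iff₀ hpi]; linarith [pi_le_four]
    linarith [(abs_le.1 hrest).2]
  refine ⟨cosPoly N ε c, r, cosPoly_nonneg hbr, ?_, by rwa [hfour], fun k hk => ?_,
    isStableGenerator_of_isLeadingEigenvalue hlead hr1, hlead, by rw [hfour]; exact hε.1,
    by rw [hfour, ← hsqrt]; exact hε.2, ?_, ?_⟩
  · refine isStationary_cosPoly h2 fun n hn hnN => ?_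
    rcases eq_or_lt_of_le hn with rfl | hn2
    · rw [cosCoeff_one, cosCoeff_one]; exact hst
    · obtain ⟨m, rfl⟩ := Int.eq_ofNat_of_zero_le (by omega : 0 ≤ n)
      rw [cosCoeff_of_two_le (N := N) (c₁ := s) (by omega) hnN, Int.natAbs_natCast]
      exact hbr.equation m (by omega) (by omega)
  · rw [fourierCos_cosPoly h2, cosCoeff_of_lt h2]
    rw [abs_of_nonneg] <;> omega
  · rw [hfour]
    exact amplitude_estimate hq hγ2 hδ0 hs hL (by positivity) hε.1 hεsq hexp
  · refine hrest.trans ?_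
    have h7 : ε ^ 3 ≤ √(12 / q) ^ 3 * (δ * √δ) := by
      have h9 : ε ≤ √(12 / q) * √δ := by rw [← hsqrt]; exact hε.2
      refine (pow_le_pow_left₀ hε0.le h9 3).trans (le_of_eq ?_)
      rw [mul_pow, pow_succ √δ 2, Real.sq_sqrt hδ0.le]
    rw [mul_assoc (120 * K ^ 4)]
    exact mul_le_mul_of_nonneg_left h7 (by positivity)

theorem rpow_three_halves {x : ℝ} (hx : 0 < x) : x ^ (3 / 2 : ℝ) = x * √x := by
  rw [Real.sqrt_eq_rpow, show (3 / 2 : ℝ) = 1 + 1 / 2 by norm_num, Real.rpow_add hx, Real.rpow_one]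

theorem IsNoiseFamily.abs_le_one {N : ℕ} {γ : ℕ → ℝ → ℝ} (h : IsNoiseFamily N γ) {s : ℝ}
    (hs : s ∈ Set.Icc (0 : ℝ) 1) : ∀ k ∈ Finset.Icc 2 N, |γ k s| ≤ 1 :=
  fun k hk => abs_le.2 (h.mem_Icc k hk s hs)

theorem pi_div_four_lt_one : π / 4 < 1 := by linarith [pi_lt_d2]

/-- The second noise coefficient is Lipschitz at the critical parameter. -/
theorem IsNoiseFamily.exists_lipschitz {N : ℕ} {γ : ℕ → ℝ → ℝ} (h : IsNoiseFamily N γ) :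
    ∃ L > 0, ∃ η > 0, ∀ s, |s - π / 4| < η → |γ 2 s - γ 2 (π / 4)| ≤ L * |s - π / 4| := by
  have hd : DifferentiableAt ℝ (γ 2) (π / 4) :=
    ((h.contDiffOn 2 (Finset.mem_Icc.2 ⟨le_rfl, h.two_le⟩)).contDiffAt
      (Icc_mem_nhds (by positivity) pi_div_four_lt_one)).differentiableAt (by norm_num)
  obtain ⟨L, hL, hb⟩ := hd.isBigO_sub.exists_pos
  obtain ⟨η, hη, hball⟩ := Metric.eventually_nhds_iff.1 hb.bound
  exact ⟨L, hL, η, hη, fun s hs => by simpa using hball (by simpa [Real.dist_eq] using hs)⟩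

end CircleAlignment

open CircleAlignment Asymptotics Topology in
theorem mainTheorem1 (N : ℕ) (γ : ℕ → ℝ → ℝ) (hγ : IsNoiseFamily N γ) :
    -- (i) the uniform distribution
    (∀ s ∈ Set.Icc (0 : ℝ) 1,
      IsStationary (noise N γ s) uniform ∧
      (s < π / 4 → IsStableGenerator (linearization (noise N γ s) uniform)) ∧
      (π / 4 < s → IsUnstableGenerator (evenLinearization (noise N γ s) uniform))) ∧
    -- (ii), (iii) the non-uniform stationary densities `f s` and their leading eigenvalues
    ∃ γmax : ℝ, π / 4 < γmax ∧ γmax ≤ 1 ∧ ∃ (f : ℝ → EvenProfile) (lam : ℝ → ℝ),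
      (∀ s ∈ Set.Ioo (π / 4) γmax,
        (∀ x, 0 ≤ f s x) ∧
        IsStationary (noise N γ s) (f s) ∧
        0 < fourierCos (f s) 1 ∧
        (∀ k, N < k → fourierCos (f s) k = 0) ∧
        IsStableGenerator (evenLinearization (noise N γ s) (f s)) ∧
        IsLeadingEigenvalue (evenGainDeriv (noise N γ s) (f s)) (lam s)) ∧
      ((fun s => fourierCos (f s) 1 - √(12 * (s - π / 4) / (π * γ 2 (π / 4))))
        =O[𝓝[>] (π / 4)] fun s => (s - π / 4) ^ (3 / 2 : ℝ)) ∧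
      ((fun s => fourierCos (f s) 1) =Θ[𝓝[>] (π / 4)] fun s => (s - π / 4) ^ (1 / 2 : ℝ)) ∧
      ((fun s => lam s - (1 - 8 / π * (s - π / 4)))
        =O[𝓝[>] (π / 4)] fun s => (s - π / 4) ^ (3 / 2 : ℝ)) := by
  have h2 := hγ.two_le
  refine ⟨fun s hs => ⟨isStationary_uniform h2 _ _,
    fun h => isStableGenerator_uniform h2 hs.1 h (hγ.abs_le_one hs),
    fun h => isUnstableGenerator_uniform h2 h⟩, ?_⟩
  obtain ⟨L, hL, η, hη, hLip⟩ := hγ.exists_lipschitz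
  have hpi := pi_pos
  have hpi1 := pi_div_four_lt_one
  set q := γ 2 (π / 4) with hqdef
  have hq : 0 < q := hγ.second_pos
  have hq1 : q ≤ 1 := (hγ.mem_Icc 2 (Finset.mem_Icc.2 ⟨le_rfl, h2⟩) _
    ⟨by positivity, hpi1.le⟩).2
  obtain ⟨K, hKN⟩ : ∃ K : ℝ, K = 2 * N + 1 := ⟨_, rfl⟩
  have hK : 0 < K := by rw [hKN]; positivity
  -- The four bounds keep the parameter below `1`, within the range of the Lipschitz bound, with `γ
  -- 2 s ≥ q / 2`, and under the smallness condition.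
  set δ₀ := min (min (1 - π / 4) η) (min (q / (2 * L)) (q ^ 3 / (10 ^ 7 * K ^ 8))) with hδ₀
  have hδ₀pos : 0 < δ₀ :=
    lt_min (lt_min (sub_pos.2 hpi1) hη) (lt_min (by positivity) (by positivity))
  have hmain : ∀ s ∈ Set.Ioo (π / 4) (π / 4 + δ₀), _ := fun s hs => by
    have hδ0 : 0 < s - π / 4 := sub_pos.2 hs.1
    have hlt : s - π / 4 < δ₀ := by linarith [hs.2]
    obtain ⟨hlt1, hlt2⟩ := lt_min_iff.1 hlt
    obtain ⟨h1, h3⟩ := lt_min_iff.1 hlt1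
    obtain ⟨h4, h5⟩ := lt_min_iff.1 hlt2
    have hb := hLip s (by rwa [abs_of_pos hδ0])
    rw [abs_of_pos hδ0] at hb
    rw [lt_div_iff₀ (by positivity)] at h4 h5
    exact exists_stationary_near_critical h2
      (hγ.abs_le_one ⟨by linarith [hs.1], by linarith⟩) hKN hq hq1 hs.1 (by linarith)
      (by linarith [(abs_le.1 hb).1]) hb (by linarith)
  -- Needed by `choose!`, which assigns arbitrary values outside the parameter interval.
  have : Nonempty EvenProfile := ⟨uniform⟩
  choose! f lam hf using hmain
  have hnhds : Set.Ioo (π / 4) (π / 4 + δ₀) ∈ 𝓝[>] (π / 4) :=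
    Ioo_mem_nhdsGT (by linarith)
  refine ⟨π / 4 + δ₀, by linarith, ?_, f, lam, fun s hs => ?_, ?_, ⟨?_, ?_⟩, ?_⟩
  · linarith [(min_le_left _ _).trans (min_le_left _ _) |> hδ₀.le.trans]
  · obtain ⟨a, b, c, d, e, g, -⟩ := hf s hs
    exact ⟨a, b, c, d, e, g⟩
  · refine IsBigO.of_bound (3 / q * ((L / 3 + 1) * (12 / q) + 8 * K ^ 4 * (12 / q) ^ 2))
      (Filter.eventually_of_mem hnhds fun s hs => ?_)
    have hδ0 : 0 < s - π / 4 := sub_pos.2 hs.1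
    obtain ⟨-, -, -, -, -, -, -, -, h, -⟩ := hf s hs
    rw [Real.norm_eq_abs, rpow_three_halves hδ0, Real.norm_eq_abs,
      abs_of_nonneg (by positivity : 0 ≤ (s - π / 4) * √(s - π / 4))]
    exact h
  · refine IsBigO.of_bound (√(12 / q)) (Filter.eventually_of_mem hnhds fun s hs => ?_)
    obtain ⟨-, -, hpos, -, -, -, -, h, -⟩ := hf s hs
    rw [Real.norm_eq_abs, abs_of_pos hpos, ← Real.sqrt_eq_rpow, Real.norm_eq_abs,
      abs_of_nonneg (Real.sqrt_nonneg _)]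
    exact h
  -- The lower bound comes from the left end `√δ` of the interval where the amplitude was found.
  · refine IsBigO.of_bound 1 (Filter.eventually_of_mem hnhds fun s hs => ?_)
    obtain ⟨-, -, hpos, -, -, -, h, -⟩ := hf s hs
    rw [one_mul, Real.norm_eq_abs, Real.norm_eq_abs, abs_of_pos hpos,
      ← Real.sqrt_eq_rpow, abs_of_nonneg (Real.sqrt_nonneg _)]
    exact h
  · refine IsBigO.of_bound (120 * K ^ 4 * √(12 / q) ^ 3)
      (Filter.eventually_of_mem hnhds fun s hs => ?_)
    have hδ0 : 0 < s - π / 4 := sub_pos.2 hs.1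
    obtain ⟨-, -, -, -, -, -, -, -, -, h⟩ := hf s hs
    rw [Real.norm_eq_abs, rpow_three_halves hδ0, Real.norm_eq_abs,
      abs_of_nonneg (by positivity : 0 ≤ (s - π / 4) * √(s - π / 4))]
    exact h
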